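/- Setting. Let $n,m\ge 1$, write $z=(x,y)\in\mathbb{R}^n\times\mathbb{R}^m$ with the Euclidean norm, let $f:\mathbb{R}^n\times\mathbb{R}^m\to\mathbb{R}$ be twice continuously differentiable on an open set $U$, and let $z^*\in U$. Write $$\nabla^2 f(z^*)=\begin{pmatrix} C & B\\ B^\top & -A\end{pmatrix},$$ and suppose that $z^*$ is a differential Stackelberg equilibrium: $\nabla_x f(z^*)=0$, $\nabla_y f(z^*)=0$, $A\succ 0$ and $C+BA^{-1}B^\top\succ 0$. Let $L\ge\max\{\|A\|_2,\|B\|_2,\|C\|_2\}$, $\mu=\lambda_{\min}(A)$, $\mu_x=\min\{L,\lambda_{\min}(C+BA^{-1}B^\top)\}$, $\kappa=L/\mu$, $\kappa_x=L/\mu_x$. Let $r\ge 2\kappa$, $\eta_x=\frac1{4rL}$, $\eta_y=\frac1{4L}$, and suppose that $$M=\begin{pmatrix} -C & -B\\ rB^\top & -rA\end{pmatrix}$$ is diagonalizable over $\mathbb{C}$, $M=P^{-1}\Lambda P$ with $\Lambda$ diagonal; put $C_P=\|P\|_2\|P^{-1}\|_2$. Algorithms. Both algorithms start from a deterministic point $z^0$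 and query a stochastic gradient oracle $g=(g_x,g_y)$. An iteration of SGDA is $x^{k+1}=x^k-\eta_x g_x(z^k)$, $y^{k+1}=y^k+\eta_y g_y(z^k)$. An iteration of stochastic EG first computes $x^{k+1/2}=x^k-\eta_x g_x(z^k)$, $y^{k+1/2}=y^k+\eta_y g_y(z^k)$, and then $x^{k+1}=x^k-\eta_x g_x(z^{k+1/2})$, $y^{k+1}=y^k+\eta_y g_y(z^{k+1/2})$. The noise of a query at a point $z$ is $\xi=(\xi_x,\xi_y)=g(z)-\nabla f(z)$ (with $\nabla f(z):=0$ at points where $f$ is not differentiable). For batch size $S$ and variance parameter $\sigma\ge 0$ it is assumed that the noises of all queries made by the algorithm are independent square-integrable random vectors with $\mathbb{E}\,\xi_x=0$, $\mathbb{E}\,\xi_y=0$, $\mathbb{E}\|\xi_x\|^2\le\sigma^2/S$ and $\mathbb{E}\|\xi_y\|^2\le\sigma^2/S$. Each query costs $S$ gradient evaluations, so that $T$ iterations cost $TS$ evaluations for SGDA and $2TS$ for EG. Theorem. There are a numerical constant $K>0$ and positive numbers $K_S(p),K_G(p)$ that depend only on $p$ such that for all data as above there is a $\delta>0$ (depending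 only on $f,U,z^*,L,r,P$) with the following property. Let $\|z^0-z^*\|\le\delta$, $0<p<1$, $\sigma\ge 0$ and $0<\varepsilon\le C_P\|z^0-z^*\|$, and put $$\ell=\max\Big\{1,\log\frac{C_P\|z^0-z^*\|}{\varepsilon}\Big\},\qquad b=\frac{r^2\kappa_x^2C_P^2\sigma^2}{L^2\varepsilon^2}\,\ell^2,\qquad T=\lceil K\,r\kappa_x\ell\,\rceil .$$ Then: 1. For every batch size $S\ge\max\{1,K_S(p)\,b\}$, the iterates of mini-batch SGDA satisfy $\|z^T-z^*\|\le\varepsilon$ with probability at least $1-p$, and so do those of mini-batch stochastic EG. 2. With the choice $S=\max\{1,\lceil K_S(p)\,b\rceil\}$, the total number of gradient evaluations of either algorithm is at most $K_G(p)\,r\kappa_x\ell\,\max\{1,b\}$. In particular, when $b\ge 1$, it is at most $K_G(p)\,\frac{r^3\kappa_x^3C_P^2\sigma^2}{L^2\varepsilon^2}\,\ell^3$. -/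

import Mathlib

open MeasureTheory ProbabilityTheory

noncomputable section

namespace Minimax

/-- The space `ℝⁿ × ℝᵐ` of points `z = (x, y)` with the Euclidean norm: the coordinates of `x` are
indexed by `Fin n` and those of `y` by `Fin m`. -/
abbrev Pt (n m : ℕ) : Type := EuclideanSpace ℝ (Fin n ⊕ Fin m)

variable {n m : ℕ}

/-- The `x`-part of `z = (x, y)`. -/
def xPart (z : Pt n m) : EuclideanSpace ℝ (Fin n) := WithLp.toLp 2 fun i => z (Sum.inl i)

/-- The `y`-part of `z = (x, y)`. -/
def yPart (z : Pt n m) : EuclideanSpace ℝ (Fin m) := WithLp.toLp 2 fun j => z (Sum.inr j)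

/-- The point `(x, y)`. -/
def mkPt (x : EuclideanSpace ℝ (Fin n)) (y : EuclideanSpace ℝ (Fin m)) : Pt n m :=
  WithLp.toLp 2 (Sum.elim (fun i => x i) (fun j => y j))

/-! ### The Hessian, its blocks, and differential Stackelberg equilibria -/

/-- The Hessian matrix of `f` at `z`; its entry at `(i, j)` is `∂ᵢ ∂ⱼ f (z)`. -/
def hessian (f : Pt n m → ℝ) (z : Pt n m) : Matrix (Fin n ⊕ Fin m) (Fin n ⊕ Fin m) ℝ :=
  Matrix.of fun i j =>
    fderiv ℝ (fderiv ℝ f) z (EuclideanSpace.single i 1) (EuclideanSpace.single j 1)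

/-- `A = -∇²_yy f (z)`. -/
def blockA (f : Pt n m → ℝ) (z : Pt n m) : Matrix (Fin m) (Fin m) ℝ := -(hessian f z).toBlocks₂₂

/-- `B = ∇²_xy f (z)`. -/
def blockB (f : Pt n m → ℝ) (z : Pt n m) : Matrix (Fin n) (Fin m) ℝ := (hessian f z).toBlocks₁₂

/-- `C = ∇²_xx f (z)`. -/
def blockC (f : Pt n m → ℝ) (z : Pt n m) : Matrix (Fin n) (Fin n) ℝ := (hessian f z).toBlocks₁₁

/-- The Schur complement `C + B A⁻¹ Bᵀ`. -/
def schur (f : Pt n m → ℝ) (z : Pt n m) : Matrix (Fin n) (Fin n) ℝ :=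
  blockC f z + blockB f z * (blockA f z)⁻¹ * (blockB f z).transpose

/-- `z` is a differential Stackelberg equilibrium of `f`: both partial gradients vanish there,
`A > 0` and `C + B A⁻¹ Bᵀ > 0`. -/
structure IsDiffStackelberg (f : Pt n m → ℝ) (z : Pt n m) : Prop where
  grad_x : xPart (gradient f z) = 0
  grad_y : yPart (gradient f z) = 0
  posDef_A : (blockA f z).PosDef
  posDef_schur : (schur f z).PosDef

/-- The spectral norm of a real or complex matrix, i.e. its operator norm with respect to the
Euclidean norms. -/
def specNorm {𝕜 ι κ : Type*} [RCLike 𝕜] [Fintype ι] [Fintype κ] [DecidableEq κ]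
    (A : Matrix ι κ 𝕜) : ℝ :=
  ‖(Matrix.toEuclideanLin A).toContinuousLinearMap‖

/-- The smallest (real) eigenvalue of a square real matrix; it is used for symmetric matrices of
positive size only, which have a nonempty finite real spectrum. -/
def lamMin {d : ℕ} (A : Matrix (Fin d) (Fin d) ℝ) : ℝ := sInf (spectrum ℝ A)

/-- `κ = L / μ` with `μ = λ_min(A)`. -/
def kappa (f : Pt n m → ℝ) (z : Pt n m) (L : ℝ) : ℝ := L / lamMin (blockA f z)

/-- `κ_x = L / μ_x` with `μ_x = min {L, λ_min(C + B A⁻¹ Bᵀ)}`. -/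
def kappaX (f : Pt n m → ℝ) (z : Pt n m) (L : ℝ) : ℝ := L / min L (lamMin (schur f z))

/-- The matrix `M = [-C, -B; r Bᵀ, -r A]`. -/
def matM (f : Pt n m → ℝ) (z : Pt n m) (r : ℝ) :
    Matrix (Fin n ⊕ Fin m) (Fin n ⊕ Fin m) ℝ :=
  Matrix.fromBlocks (-blockC f z) (-blockB f z)
    (r • (blockB f z).transpose) (-(r • blockA f z))

/-- `M = P⁻¹ Λ P` is an eigenvalue decomposition of the real matrix `M` over `ℂ`. -/
def IsEigDecomp {ι : Type*} [Fintype ι] [DecidableEq ι] (M : Matrix ι ι ℝ) (P : Matrix ι ι ℂ)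
    (ev : ι → ℂ) : Prop :=
  IsUnit P.det ∧ M.map (fun a : ℝ => (a : ℂ)) = P⁻¹ * Matrix.diagonal ev * P

/-- The condition number `C_P = ‖P‖₂ ‖P⁻¹‖₂`. -/
def condNum {ι : Type*} [Fintype ι] [DecidableEq ι] (P : Matrix ι ι ℂ) : ℝ :=
  specNorm P * specNorm P⁻¹

/-! ### Stochastic dynamics

A stochastic oracle is a sequence of random vector fields `g j ω : ℝⁿ × ℝᵐ → ℝⁿ × ℝᵐ`; the `j`-th
query, made at the point `z`, returns `g j ω z = (g_x, g_y)`. -/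

variable {Ω : Type*}

/-- `(x - η_x g_x, y + η_y g_y)`. -/
def step (ηx ηy : ℝ) (z g : Pt n m) : Pt n m :=
  mkPt (xPart z - ηx • xPart g) (yPart z + ηy • yPart g)

/-- The iterates of stochastic gradient descent ascent: iteration `k` uses query `k`. -/
def sgda (g : ℕ → Ω → Pt n m → Pt n m) (ηx ηy : ℝ) (z₀ : Pt n m) : ℕ → Ω → Pt n m
  | 0, _ => z₀
  | k + 1, ω => step ηx ηy (sgda g ηx ηy z₀ k ω) (g k ω (sgda g ηx ηy z₀ k ω))

/-- The iterates of stochastic extra-gradient: iteration `k` uses query `2k` at `z^k` to obtain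
`z^{k+1/2}`, and then query `2k+1` at `z^{k+1/2}` to obtain `z^{k+1}` from `z^k`. -/
def seg (g : ℕ → Ω → Pt n m → Pt n m) (ηx ηy : ℝ) (z₀ : Pt n m) : ℕ → Ω → Pt n m
  | 0, _ => z₀
  | k + 1, ω =>
    step ηx ηy (seg g ηx ηy z₀ k ω)
      (g (2 * k + 1) ω
        (step ηx ηy (seg g ηx ηy z₀ k ω) (g (2 * k) ω (seg g ηx ηy z₀ k ω))))

/-- The point of the `j`-th query of stochastic extra-gradient: `z^k` if `j = 2k`, and `z^{k+1/2}`
if `j = 2k+1`. -/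
def segQuery (g : ℕ → Ω → Pt n m → Pt n m) (ηx ηy : ℝ) (z₀ : Pt n m) (j : ℕ) (ω : Ω) : Pt n m :=
  if j % 2 = 0 then seg g ηx ηy z₀ (j / 2) ω
  else step ηx ηy (seg g ηx ηy z₀ (j / 2) ω)
    (g (2 * (j / 2)) ω (seg g ηx ηy z₀ (j / 2) ω))

/-- The noise of the `j`-th query, made at the random point `q j`: what the oracle returns minus the
true gradient. -/
def noise (f : Pt n m → ℝ) (g : ℕ → Ω → Pt n m → Pt n m) (q : ℕ → Ω → Pt n m)
    (j : ℕ) (ω : Ω) : Pt n m :=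
  g j ω (q j ω) - gradient f (q j ω)

/-- The noises `ξ j = (ξ_x j, ξ_y j)` of a mini-batch gradient with batch size `S` are
square-integrable random vectors, have mean zero, satisfy `E ‖ξ_x‖² ≤ σ² / S` and
`E ‖ξ_y‖² ≤ σ² / S`, and are independent for different queries. -/
structure IsMiniBatchNoise [MeasurableSpace Ω] (P : Measure Ω) (σ : ℝ) (S : ℕ)
    (ξ : ℕ → Ω → Pt n m) : Prop where
  memLp : ∀ j, MemLp (ξ j) 2 P
  mean_x : ∀ j, ∫ ω, xPart (ξ j ω) ∂P = 0
  mean_y : ∀ j, ∫ ω, yPart (ξ j ω) ∂P = 0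
  var_x : ∀ j, ∫ ω, ‖xPart (ξ j ω)‖ ^ 2 ∂P ≤ σ ^ 2 / S
  var_y : ∀ j, ∫ ω, ‖yPart (ξ j ω)‖ ^ 2 ∂P ≤ σ ^ 2 / S
  indep : iIndepFun ξ P

/-- Gradient evaluations of `T` iterations of mini-batch SGDA (one query per iteration, `S`
evaluations per query). -/
def sgdaCost (T S : ℕ) : ℕ := T * S

/-- Gradient evaluations of `T` iterations of mini-batch stochastic EG (two queries per
iteration, `S` evaluations per query). -/
def segCost (T S : ℕ) : ℕ := 2 * T * S

/-- The logarithmic factor `max {1, log (C_P ‖z⁰ - z*‖ / ε)}`, with `d = ‖z⁰ - z*‖`. -/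
def logFactor (CP d ε : ℝ) : ℝ := max 1 (Real.log (CP * d / ε))

/-- The expression `r² κ_x² C_P² σ² / (L² ε²) · ℓ²` that governs the batch size. -/
def batchFactor (r κx CP σ L ε ℓ : ℝ) : ℝ :=
  r ^ 2 * κx ^ 2 * CP ^ 2 * σ ^ 2 / (L ^ 2 * ε ^ 2) * ℓ ^ 2

end Minimax

end

open Minimax

/-!
The linearization of both algorithms at `z*` is governed by `ηx M`. Let `z` be an eigenvalue of `M`
with eigenvector `(u, v)`. Pairing the two eigenvector equations with `u` and `v` shows that a
nonreal `z` forces `‖v‖² = r ‖u‖²`, whence `Re z ≤ -L / 2` and `|z|² ≤ 3 r L²`, while a real `z`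
lies in `[-r L, -μx]`: otherwise testing the Schur complement with `u` yields a contradiction. With
`x = ηx z`, a step of SGDA multiplies the eigenvector by `1 + x` and a step of EG by `1 + x + x²`,
and both factors have modulus at most `1 - 1 / (32 r κx)`. Hence the linearized algorithms contract
the norm `‖P e‖` at this rate; near `z*` the Taylor remainder of the gradient uses up at most half
of it. The noise enters the recursion additively, so it suffices to bound the sum of the norms of
all the noise vectors, which Cauchy–Schwarz and Markov's inequality do with probability `1 - p`.
-/

namespace Minimax

section Spectrum

open RCLike
open scoped ComplexConjugate InnerProductSpace

variable {𝕜 X Y : Type*} [RCLike 𝕜] [NormedAddCommGroup X] [InnerProductSpace 𝕜 X]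
  [NormedAddCommGroup Y] [InnerProductSpace 𝕜 Y]

/-- The blocks of a Hessian `[C, B; B', -A]` at a strict Stackelberg equilibrium, as operators
between inner product spaces: `B'` is adjoint to `B`, the blocks are bounded by `L`, `A ≥ μ`, and
the Schur complement `C + B A⁻¹ B'` is at least `μx`. -/
structure StackelbergBlocks (A : Y →ₗ[𝕜] Y) (B : Y →ₗ[𝕜] X) (B' : X →ₗ[𝕜] Y) (C : X →ₗ[𝕜] X)
    (L μ μx : ℝ) : Prop where
  symm_A : A.IsSymmetric
  symm_C : C.IsSymmetric
  adjoint : ∀ x y, ⟪B' x, y⟫_𝕜 = ⟪x, B y⟫_𝕜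
  norm_A_le : ∀ y, ‖A y‖ ≤ L * ‖y‖
  norm_B_le : ∀ y, ‖B y‖ ≤ L * ‖y‖
  norm_C_le : ∀ x, ‖C x‖ ≤ L * ‖x‖
  surjective_A : Function.Surjective A
  coercive_A : ∀ y, μ * ‖y‖ ^ 2 ≤ re ⟪y, A y⟫_𝕜
  coercive_schur : ∀ x y, A y = B' x → μx * ‖x‖ ^ 2 ≤ re ⟪x, C x⟫_𝕜 + re ⟪x, B y⟫_𝕜
  mu_pos : 0 < μ
  mux_pos : 0 < μx
  mux_le : μx ≤ L

/-- `(u, v)` is an eigenvector, with eigenvalue `z`, of the preconditioned negative Hessian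
`[-C, -B; r B', -r A]`. -/
structure IsEigenpair (A : Y →ₗ[𝕜] Y) (B : Y →ₗ[𝕜] X) (B' : X →ₗ[𝕜] Y) (C : X →ₗ[𝕜] X)
    (r : ℝ) (z : 𝕜) (u : X) (v : Y) : Prop where
  fst_eq : z • u = -C u - B v
  snd_eq : z • v = (r : 𝕜) • (B' u - A v)
  ne_zero : u ≠ 0 ∨ v ≠ 0

lemma abs_re_inner_self_map_le {T : X →ₗ[𝕜] X} {c : ℝ} (hT : ∀ x, ‖T x‖ ≤ c * ‖x‖) (x : X) :
    |re ⟪x, T x⟫_𝕜| ≤ c * ‖x‖ ^ 2 :=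
  calc |re ⟪x, T x⟫_𝕜| ≤ ‖x‖ * ‖T x‖ := (abs_re_le_norm _).trans (norm_inner_le_norm x (T x))
    _ ≤ ‖x‖ * (c * ‖x‖) := by gcongr; exact hT x
    _ = c * ‖x‖ ^ 2 := by ring

variable {A : Y →ₗ[𝕜] Y} {B : Y →ₗ[𝕜] X} {B' : X →ₗ[𝕜] Y} {C : X →ₗ[𝕜] X} {L μ μx r : ℝ}
  {z : 𝕜} {u : X} {v : Y}

namespace IsEigenpair

lemma mul_norm_fst_sq (hz : IsEigenpair A B B' C r z u v) :
    z * (‖u‖ ^ 2 : ℝ) = -⟪u, C u⟫_𝕜 - ⟪u, B v⟫_𝕜 := by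
  have := congrArg (inner 𝕜 u) hz.fst_eq
  rwa [inner_smul_right, inner_self_eq_norm_sq_to_K, inner_sub_right, inner_neg_right,
    ← ofReal_pow] at this

lemma re_mul_norm_fst_sq (hz : IsEigenpair A B B' C r z u v) :
    re z * ‖u‖ ^ 2 = -re ⟪u, C u⟫_𝕜 - re ⟪u, B v⟫_𝕜 := by
  simpa only [re_mul_ofReal, map_sub, map_neg] using congrArg re hz.mul_norm_fst_sq

lemma norm_fst_sq_pos (hz : IsEigenpair A B B' C r z u v) (huv : ‖v‖ ^ 2 = r * ‖u‖ ^ 2) :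
    0 < ‖u‖ ^ 2 := by
  have hu : u ≠ 0 := fun h0 => hz.ne_zero.elim (· h0) (· (by simpa [h0] using huv))
  positivity

lemma exists_fst_eq_add_smul (hz : IsEigenpair A B B' C r z u v) (hr : r ≠ 0) (him : im z = 0) :
    ∃ t : ℝ, re z = r * t ∧ B' u = A v + (t : 𝕜) • v := by
  obtain ⟨t, ht⟩ : ∃ t : ℝ, re z = r * t := ⟨re z / r, (mul_div_cancel₀ _ hr).symm⟩
  have hzt : z = r * t := RCLike.ext (by simp [ht]) (by simp [him])
  have hr' : (r : 𝕜) ≠ 0 := ofReal_ne_zero.2 hr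
  have htv : (t : 𝕜) • v = B' u - A v := by
    rw [← smul_right_inj hr', ← mul_smul, ← hzt, hz.snd_eq]
  exact ⟨t, ht, by rw [htv, add_sub_cancel]⟩

end IsEigenpair

namespace StackelbergBlocks

lemma L_pos (h : StackelbergBlocks A B B' C L μ μx) : 0 < L := h.mux_pos.trans_le h.mux_le

lemma mul_norm_snd_sq (h : StackelbergBlocks A B B' C L μ μx)
    (hz : IsEigenpair A B B' C r z u v) :
    z * (‖v‖ ^ 2 : ℝ) = r * (conj ⟪u, B v⟫_𝕜 - ⟪v, A v⟫_𝕜) := by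
  have := congrArg (inner 𝕜 v) hz.snd_eq
  rwa [inner_smul_right, inner_self_eq_norm_sq_to_K, inner_smul_right, inner_sub_right,
    ← inner_conj_symm v (B' u), h.adjoint, ← ofReal_pow] at this

lemma re_mul_norm_snd_sq (h : StackelbergBlocks A B B' C L μ μx)
    (hz : IsEigenpair A B B' C r z u v) :
    re z * ‖v‖ ^ 2 = r * (re ⟪u, B v⟫_𝕜 - re ⟪v, A v⟫_𝕜) := by
  simpa only [re_mul_ofReal, re_ofReal_mul, map_sub, conj_re]
    using congrArg re (h.mul_norm_snd_sq hz)

lemma re_mul_energy (h : StackelbergBlocks A B B' C L μ μx) (hz : IsEigenpair A B B' C r z u v) :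
    re z * (r * ‖u‖ ^ 2 + ‖v‖ ^ 2) = -(r * (re ⟪u, C u⟫_𝕜 + re ⟪v, A v⟫_𝕜)) := by
  linear_combination r * hz.re_mul_norm_fst_sq + h.re_mul_norm_snd_sq hz

lemma norm_snd_sq_eq (h : StackelbergBlocks A B B' C L μ μx) (hz : IsEigenpair A B B' C r z u v)
    (him : im z ≠ 0) : ‖v‖ ^ 2 = r * ‖u‖ ^ 2 := by
  have hfst := congrArg im hz.mul_norm_fst_sq
  have hsnd := congrArg im (h.mul_norm_snd_sq hz)
  simp only [im_mul_ofReal, im_ofReal_mul, map_sub, map_neg, conj_im,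
    h.symm_C.im_inner_self_apply, h.symm_A.im_inner_self_apply] at hfst hsnd
  exact mul_left_cancel₀ him (by linear_combination hsnd - r * hfst)

lemma neg_le_re_eigenvalue (h : StackelbergBlocks A B B' C L μ μx)
    (hz : IsEigenpair A B B' C r z u v) (hr : 1 ≤ r) : -(r * L) ≤ re z := by
  have hpos : 0 < r * ‖u‖ ^ 2 + ‖v‖ ^ 2 := by
    rcases hz.ne_zero with h0 | h0 <;> have := norm_pos_iff.2 h0 <;> positivity
  have hC := (abs_le.1 (abs_re_inner_self_map_le h.norm_C_le u)).2
  have hA := (abs_le.1 (abs_re_inner_self_map_le h.norm_A_le v)).2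
  refine le_of_mul_le_mul_right ?_ hpos
  calc -(r * L) * (r * ‖u‖ ^ 2 + ‖v‖ ^ 2)
      ≤ -(r * (L * ‖u‖ ^ 2 + L * ‖v‖ ^ 2)) := by
        have : 0 ≤ r * L * ((r - 1) * ‖u‖ ^ 2) :=
          mul_nonneg (mul_nonneg (by linarith) h.L_pos.le)
            (mul_nonneg (by linarith) (sq_nonneg _))
        linarith
    _ ≤ -(r * (re ⟪u, C u⟫_𝕜 + re ⟪v, A v⟫_𝕜)) := by gcongr
    _ = re z * (r * ‖u‖ ^ 2 + ‖v‖ ^ 2) := (h.re_mul_energy hz).symm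

lemma mul_re_inner_le_norm_sq (h : StackelbergBlocks A B B' C L μ μx) {y : Y} (hy : A y = v) :
    μ * re ⟪v, y⟫_𝕜 ≤ ‖v‖ ^ 2 := by
  have hle : re ⟪v, y⟫_𝕜 ≤ ‖v‖ * ‖y‖ := re_inner_le_norm v y
  have hcoer : μ * ‖y‖ ^ 2 ≤ re ⟪v, y⟫_𝕜 := by
    simpa only [hy, inner_re_symm] using h.coercive_A y
  have hy_le : μ * ‖y‖ ≤ ‖v‖ := by
    rcases (norm_nonneg y).eq_or_lt with h0 | h0
    · simp [← h0]
    · exact le_of_mul_le_mul_right (by linarith) h0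
  have hμ := mul_le_mul_of_nonneg_left hle h.mu_pos.le
  have hv := mul_le_mul_of_nonneg_left hy_le (norm_nonneg v)
  linarith

/-- Bounding the Schur complement at the solution `v + t A⁻¹ v` of `A y = B' u`. -/
lemma schur_gap (h : StackelbergBlocks A B B' C L μ μx) {t : ℝ} (huv : B' u = A v + (t : 𝕜) • v) :
    μ * (μx * ‖u‖ ^ 2) ≤
      μ * (re ⟪u, C u⟫_𝕜 + re ⟪u, B v⟫_𝕜) + t * (μ + t) * ‖v‖ ^ 2 := by
  obtain ⟨y, hy⟩ := h.surjective_A v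
  have hBy : re ⟪u, B y⟫_𝕜 = ‖v‖ ^ 2 + t * re ⟪v, y⟫_𝕜 := by
    rw [← h.adjoint, huv, inner_add_left, h.symm_A, hy, inner_smul_left, conj_ofReal, map_add,
      re_ofReal_mul, inner_self_eq_norm_sq]
  have hschur := h.coercive_schur u (v + (t : 𝕜) • y) (by rw [map_add, map_smul, hy, huv])
  rw [map_add, map_smul, inner_add_right, inner_smul_right, map_add, re_ofReal_mul, hBy]
    at hschur
  have hμ := mul_le_mul_of_nonneg_left hschur h.mu_pos.le
  have ht := mul_le_mul_of_nonneg_left (h.mul_re_inner_le_norm_sq hy) (sq_nonneg t)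
  linarith

lemma re_eigenvalue_le_of_fst_eq_zero (h : StackelbergBlocks A B B' C L μ μx)
    (hz : IsEigenpair A B B' C r z u v) (hr : 0 ≤ r) (hu : u = 0) : re z ≤ -(r * μ) := by
  have hv : 0 < ‖v‖ ^ 2 := by
    have := norm_pos_iff.2 (hz.ne_zero.resolve_left (not_not.2 hu))
    positivity
  have hsnd : re z * ‖v‖ ^ 2 = -(r * re ⟪v, A v⟫_𝕜) := by
    simpa only [hu, inner_zero_left, map_zero, zero_sub, mul_neg] using h.re_mul_norm_snd_sq hz
  refine le_of_mul_le_mul_right ?_ hv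
  linarith [mul_le_mul_of_nonneg_left (h.coercive_A v) hr]

lemma re_eigenvalue_le_of_im_eq_zero (h : StackelbergBlocks A B B' C L μ μx)
    (hz : IsEigenpair A B B' C r z u v) (hr : 0 < r) (hrμ : 2 * L ≤ r * μ) (him : im z = 0) :
    re z ≤ -μx := by
  have hL := h.L_pos
  have hμ := h.mu_pos
  by_cases hu0 : u = 0
  · linarith [h.re_eigenvalue_le_of_fst_eq_zero hz hr.le hu0, h.mux_le]
  have hu : 0 < ‖u‖ ^ 2 := by positivity
  by_contra! hlt
  obtain ⟨t, hzt, huv⟩ := hz.exists_fst_eq_add_smul hr.ne' him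
  have hfst := hz.re_mul_norm_fst_sq
  have hgap := h.schur_gap huv
  have hgap_pos : 0 < μ * ((re z + μx) * ‖u‖ ^ 2) := mul_pos hμ (mul_pos (by linarith) hu)
  have hμt : 0 < μ + t := pos_of_mul_pos_right (a := r) (by linarith [h.mux_le]) hr.le
  have ht_pos : 0 < t := by
    have : 0 < t * ((μ + t) * ‖v‖ ^ 2) := by linear_combination hgap_pos + hgap + μ * hfst
    exact pos_of_mul_pos_left this (by positivity)
  have hBv : re ⟪u, B v⟫_𝕜 = re ⟪v, A v⟫_𝕜 + t * ‖v‖ ^ 2 := by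
    rw [← h.adjoint, huv, inner_add_left, h.symm_A, inner_smul_left, conj_ofReal, map_add,
      re_ofReal_mul, inner_self_eq_norm_sq]
  have hv : (μ + t) * ‖v‖ ^ 2 ≤ L * ‖u‖ ^ 2 := by
    have hC := (abs_le.1 (abs_re_inner_self_map_le h.norm_C_le u)).1
    have : 0 ≤ re z * ‖u‖ ^ 2 := by rw [hzt]; positivity
    linarith [h.coercive_A v]
  have hLt : 2 * L * (t * ‖u‖ ^ 2) ≤ r * μ * (t * ‖u‖ ^ 2) := by gcongr
  have hμx : 0 < μ * (μx * ‖u‖ ^ 2) := mul_pos hμ (mul_pos h.mux_pos hu)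
  have htu : 0 ≤ L * (t * ‖u‖ ^ 2) := by positivity
  have htv := mul_le_mul_of_nonneg_left hv ht_pos.le
  rw [hzt] at hfst
  linarith [congrArg (μ * ·) hfst]

lemma re_eigenvalue_le_of_im_ne_zero (h : StackelbergBlocks A B B' C L μ μx)
    (hz : IsEigenpair A B B' C r z u v) (hr : 0 < r) (hrμ : 2 * L ≤ r * μ) (him : im z ≠ 0) :
    re z ≤ -(L / 2) := by
  have hv := h.norm_snd_sq_eq hz him
  have hu : 0 < ‖u‖ ^ 2 := hz.norm_fst_sq_pos hv
  have hC := (abs_le.1 (abs_re_inner_self_map_le h.norm_C_le u)).1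
  have hA := h.coercive_A v
  have henergy := h.re_mul_energy hz
  rw [hv] at hA henergy
  refine le_of_mul_le_mul_right ?_ (show 0 < 2 * (r * ‖u‖ ^ 2) by positivity)
  have hμ : 2 * L * ‖u‖ ^ 2 ≤ r * μ * ‖u‖ ^ 2 := by gcongr
  have hCA : L * ‖u‖ ^ 2 ≤ re ⟪u, C u⟫_𝕜 + re ⟪v, A v⟫_𝕜 := by linarith
  linarith [mul_le_mul_of_nonneg_left hCA hr.le]

lemma norm_eigenvalue_sq_le (h : StackelbergBlocks A B B' C L μ μx)
    (hz : IsEigenpair A B B' C r z u v) (hr : 2 ≤ r) (him : im z ≠ 0) :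
    ‖z‖ ^ 2 ≤ 3 * r * L ^ 2 := by
  have hv := h.norm_snd_sq_eq hz him
  have hu : 0 < ‖u‖ ^ 2 := hz.norm_fst_sq_pos hv
  refine le_of_mul_le_mul_right ?_ hu
  have hzu : ‖z‖ * ‖u‖ ≤ L * (‖u‖ + ‖v‖) :=
    calc ‖z‖ * ‖u‖ = ‖-C u - B v‖ := by rw [← norm_smul, hz.fst_eq]
      _ ≤ ‖C u‖ + ‖B v‖ := (norm_sub_le _ _).trans_eq (by rw [norm_neg])
      _ ≤ L * (‖u‖ + ‖v‖) := by linarith [h.norm_C_le u, h.norm_B_le v]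
  calc ‖z‖ ^ 2 * ‖u‖ ^ 2 = (‖z‖ * ‖u‖) ^ 2 := by ring
    _ ≤ (L * (‖u‖ + ‖v‖)) ^ 2 := by gcongr
    _ ≤ L ^ 2 * (2 * (‖u‖ ^ 2 + ‖v‖ ^ 2)) := by rw [mul_pow]; gcongr; exact add_sq_le
    _ = L ^ 2 * ‖u‖ ^ 2 * (2 + 2 * r) := by rw [hv]; ring
    _ ≤ L ^ 2 * ‖u‖ ^ 2 * (3 * r) := by gcongr; linarith
    _ = 3 * r * L ^ 2 * ‖u‖ ^ 2 := by ring

lemma eigenvalue_bounds (h : StackelbergBlocks A B B' C L μ μx)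
    (hz : IsEigenpair A B B' C r z u v) (hr : 2 ≤ r) (hrμ : 2 * L ≤ r * μ) :
    (im z = 0 ∧ -(r * L) ≤ re z ∧ re z ≤ -μx) ∨
      (re z ≤ -(L / 2) ∧ ‖z‖ ^ 2 ≤ 3 * r * L ^ 2) := by
  by_cases him : im z = 0
  · exact .inl ⟨him, h.neg_le_re_eigenvalue hz (by linarith),
      h.re_eigenvalue_le_of_im_eq_zero hz (by linarith) hrμ him⟩
  · exact .inr ⟨h.re_eigenvalue_le_of_im_ne_zero hz (by linarith) hrμ him,
      h.norm_eigenvalue_sq_le hz hr him⟩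

end StackelbergBlocks

end Spectrum

section Matrices

open Matrix
open scoped InnerProductSpace

section SpecNorm

variable {𝕜 ι κ : Type*} [RCLike 𝕜] [Fintype ι] [Fintype κ] [DecidableEq κ]

lemma specNorm_nonneg (A : Matrix ι κ 𝕜) : 0 ≤ specNorm A := norm_nonneg _

lemma norm_toEuclideanLin_le (A : Matrix ι κ 𝕜) (x : EuclideanSpace 𝕜 κ) :
    ‖toEuclideanLin A x‖ ≤ specNorm A * ‖x‖ :=
  (toEuclideanLin A).toContinuousLinearMap.le_opNorm x

end SpecNorm

section LamMin

variable {d : ℕ} {A : Matrix (Fin d) (Fin d) ℝ}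

lemma lamMin_mul_norm_sq_le (hA : A.IsHermitian) (y : EuclideanSpace ℝ (Fin d)) :
    lamMin A * ‖y‖ ^ 2 ≤ ⟪y, toEuclideanLin A y⟫_ℝ := by
  have hpsd : (A - algebraMap ℝ _ (lamMin A)).PosSemidef := by
    refine posSemidef_iff_isHermitian_and_spectrum_nonneg.2
      ⟨hA.sub (by simp [IsHermitian, algebraMap_eq_diagonal]), ?_⟩
    rw [← spectrum.sub_singleton_eq]
    rintro _ ⟨c, hc, _, rfl, rfl⟩
    exact sub_nonneg.2 (csInf_le A.finite_real_spectrum.bddBelow hc)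
  have hnonneg := (isPositive_toEuclideanLin_iff.2 hpsd).inner_nonneg_right y
  rw [Algebra.algebraMap_eq_smul_one, map_sub, map_smul, toLpLin_one, LinearMap.sub_apply,
    LinearMap.smul_apply, LinearMap.id_apply, inner_sub_right, real_inner_smul_right,
    real_inner_self_eq_norm_sq] at hnonneg
  exact sub_nonneg.1 hnonneg

lemma lamMin_pos (hd : 0 < d) (hA : A.PosDef) : 0 < lamMin A := by
  have hne : (spectrum ℝ A).Nonempty := by
    rw [hA.1.spectrum_real_eq_range_eigenvalues]
    exact ⟨_, ⟨0, hd⟩, rfl⟩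
  have hmem : lamMin A ∈ spectrum ℝ A := hne.csInf_mem A.finite_real_spectrum
  rw [hA.1.spectrum_real_eq_range_eigenvalues] at hmem
  obtain ⟨i, hi⟩ := hmem
  exact hi ▸ hA.eigenvalues_pos i

lemma lamMin_le_specNorm (hd : 0 < d) (hA : A.IsHermitian) : lamMin A ≤ specNorm A := by
  set e : EuclideanSpace ℝ (Fin d) := EuclideanSpace.single ⟨0, hd⟩ 1
  have he : ‖e‖ = 1 := by simp [e]
  calc lamMin A = lamMin A * ‖e‖ ^ 2 := by rw [he]; ring
    _ ≤ ⟪e, toEuclideanLin A e⟫_ℝ := lamMin_mul_norm_sq_le hA e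
    _ ≤ ‖e‖ * ‖toEuclideanLin A e‖ := real_inner_le_norm _ _
    _ ≤ ‖e‖ * (specNorm A * ‖e‖) := by gcongr; exact norm_toEuclideanLin_le A e
    _ = specNorm A := by rw [he]; ring

end LamMin

section Complexification

variable {ι κ τ : Type*}

/-- The coordinatewise real part of a complex vector. -/
noncomputable def rePart (x : EuclideanSpace ℂ ι) : EuclideanSpace ℝ ι :=
  WithLp.toLp 2 fun i => (x i).re

/-- The coordinatewise imaginary part of a complex vector. -/
noncomputable def imPart (x : EuclideanSpace ℂ ι) : EuclideanSpace ℝ ι :=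
  WithLp.toLp 2 fun i => (x i).im

lemma re_inner_eq_add [Fintype ι] (x y : EuclideanSpace ℂ ι) :
    RCLike.re ⟪x, y⟫_ℂ = ⟪rePart x, rePart y⟫_ℝ + ⟪imPart x, imPart y⟫_ℝ := by
  simp [PiLp.inner_apply, rePart, imPart, Finset.sum_add_distrib, mul_comm]

lemma norm_sq_eq_rePart_add_imPart [Fintype ι] (x : EuclideanSpace ℂ ι) :
    ‖x‖ ^ 2 = ‖rePart x‖ ^ 2 + ‖imPart x‖ ^ 2 := by
  simpa only [inner_self_eq_norm_sq, real_inner_self_eq_norm_sq] using re_inner_eq_add x x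

variable [Fintype κ] [DecidableEq κ]

/-- The extension of a real matrix to a linear map between complex Euclidean spaces. -/
noncomputable def complexLin (A : Matrix ι κ ℝ) :
    EuclideanSpace ℂ κ →ₗ[ℂ] EuclideanSpace ℂ ι :=
  toEuclideanLin (A.map fun a : ℝ => (a : ℂ))

lemma rePart_complexLin (A : Matrix ι κ ℝ) (x : EuclideanSpace ℂ κ) :
    rePart (complexLin A x) = toEuclideanLin A (rePart x) := by
  ext i
  simp [complexLin, rePart, toLpLin_apply, mulVec, dotProduct]

lemma imPart_complexLin (A : Matrix ι κ ℝ) (x : EuclideanSpace ℂ κ) :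
    imPart (complexLin A x) = toEuclideanLin A (imPart x) := by
  ext i
  simp [complexLin, imPart, toLpLin_apply, mulVec, dotProduct]

lemma complexLin_add (A B : Matrix ι κ ℝ) :
    complexLin (A + B) = complexLin A + complexLin B := by
  rw [complexLin, Matrix.map_add _ Complex.ofReal_add, map_add, complexLin, complexLin]

lemma complexLin_mul [Fintype τ] [DecidableEq τ] (A : Matrix ι κ ℝ) (B : Matrix κ τ ℝ) :
    complexLin (A * B) = complexLin A ∘ₗ complexLin B := by
  rw [complexLin, ← Complex.coe_algebraMap, Matrix.map_mul, toLpLin_mul_same]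
  rfl

lemma complexLin_one [Fintype ι] [DecidableEq ι] :
    complexLin (1 : Matrix ι ι ℝ) = LinearMap.id := by
  rw [complexLin, Matrix.map_one _ Complex.ofReal_zero Complex.ofReal_one, toLpLin_one]

variable [Fintype ι]

lemma complexLin_mul_apply_of_mul_eq_one [DecidableEq ι] {A B : Matrix ι ι ℝ} (h : A * B = 1)
    (x : EuclideanSpace ℂ ι) : complexLin A (complexLin B x) = x := by
  rw [← LinearMap.comp_apply, ← complexLin_mul, h, complexLin_one, LinearMap.id_apply]

lemma complexLin_transpose_inner [DecidableEq ι] (A : Matrix ι κ ℝ)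
    (x : EuclideanSpace ℂ ι) (y : EuclideanSpace ℂ κ) :
    ⟪complexLin Aᵀ x, y⟫_ℂ = ⟪x, complexLin A y⟫_ℂ := by
  have hA : Aᵀ.map (fun a : ℝ => (a : ℂ)) = (A.map fun a : ℝ => (a : ℂ))ᴴ := by
    ext; simp
  rw [complexLin, hA, toEuclideanLin_conjTranspose_eq_adjoint, LinearMap.adjoint_inner_left,
    complexLin]

lemma isSymmetric_complexLin [DecidableEq ι] {A : Matrix ι ι ℝ} (hA : A.IsHermitian) :
    (complexLin A).IsSymmetric := fun x y => by
  rw [← complexLin_transpose_inner, ← conjTranspose_eq_transpose_of_trivial, hA.eq]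

lemma norm_complexLin_le (A : Matrix ι κ ℝ) (x : EuclideanSpace ℂ κ) :
    ‖complexLin A x‖ ≤ specNorm A * ‖x‖ := by
  refine le_of_sq_le_sq ?_ (mul_nonneg (specNorm_nonneg A) (norm_nonneg x))
  rw [mul_pow, norm_sq_eq_rePart_add_imPart, norm_sq_eq_rePart_add_imPart, rePart_complexLin,
    imPart_complexLin, mul_add, ← mul_pow, ← mul_pow]
  gcongr <;> exact norm_toEuclideanLin_le A _

lemma lamMin_mul_norm_sq_le_re_inner {d : ℕ} {A : Matrix (Fin d) (Fin d) ℝ} (hA : A.IsHermitian)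
    (x : EuclideanSpace ℂ (Fin d)) : lamMin A * ‖x‖ ^ 2 ≤ RCLike.re ⟪x, complexLin A x⟫_ℂ := by
  rw [re_inner_eq_add, norm_sq_eq_rePart_add_imPart, rePart_complexLin, imPart_complexLin, mul_add]
  exact add_le_add (lamMin_mul_norm_sq_le hA _) (lamMin_mul_norm_sq_le hA _)

end Complexification

section Stackelberg

variable {n m : ℕ} {f : Pt n m → ℝ} {zs : Pt n m} {L r : ℝ}

lemma IsDiffStackelberg.isHermitian_blockC (hz : IsDiffStackelberg f zs) :
    (blockC f zs).IsHermitian := by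
  have h : blockC f zs = schur f zs - blockB f zs * (blockA f zs)⁻¹ * (blockB f zs)ᴴ := by
    rw [schur, conjTranspose_eq_transpose_of_trivial, add_sub_cancel_right]
  rw [h]
  exact hz.posDef_schur.1.sub (isHermitian_mul_mul_conjTranspose _ hz.posDef_A.1.inv)

lemma IsDiffStackelberg.lamMin_blockA_le (hz : IsDiffStackelberg f zs) (hm : 0 < m)
    (hA : specNorm (blockA f zs) ≤ L) : lamMin (blockA f zs) ≤ L :=
  (lamMin_le_specNorm hm hz.posDef_A.1).trans hA

lemma complexLin_schur_apply (hA : IsUnit (blockA f zs).det) {x : EuclideanSpace ℂ (Fin n)}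
    {y : EuclideanSpace ℂ (Fin m)}
    (hy : complexLin (blockA f zs) y = complexLin (blockB f zs)ᵀ x) :
    complexLin (schur f zs) x = complexLin (blockC f zs) x + complexLin (blockB f zs) y := by
  rw [schur, complexLin_add, complexLin_mul, complexLin_mul, LinearMap.add_apply,
    LinearMap.comp_apply, LinearMap.comp_apply, ← hy,
    complexLin_mul_apply_of_mul_eq_one (nonsing_inv_mul _ hA)]

lemma IsDiffStackelberg.stackelbergBlocks (hz : IsDiffStackelberg f zs) (hn : 0 < n) (hm : 0 < m)
    (hA : specNorm (blockA f zs) ≤ L) (hB : specNorm (blockB f zs) ≤ L)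
    (hC : specNorm (blockC f zs) ≤ L) :
    StackelbergBlocks (complexLin (blockA f zs)) (complexLin (blockB f zs))
      (complexLin (blockB f zs)ᵀ) (complexLin (blockC f zs)) L (lamMin (blockA f zs))
      (min L (lamMin (schur f zs))) := by
  have hμ : 0 < lamMin (blockA f zs) := lamMin_pos hm hz.posDef_A
  have hL : 0 < L := hμ.trans_le (hz.lamMin_blockA_le hm hA)
  have hdet : IsUnit (blockA f zs).det := hz.posDef_A.det_pos.ne'.isUnit
  exact
    { symm_A := isSymmetric_complexLin hz.posDef_A.1
      symm_C := isSymmetric_complexLin hz.isHermitian_blockC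
      adjoint := complexLin_transpose_inner _
      norm_A_le y := (norm_complexLin_le _ y).trans (by gcongr)
      norm_B_le y := (norm_complexLin_le _ y).trans (by gcongr)
      norm_C_le x := (norm_complexLin_le _ x).trans (by gcongr)
      surjective_A y := ⟨_, complexLin_mul_apply_of_mul_eq_one (mul_nonsing_inv _ hdet) y⟩
      coercive_A := lamMin_mul_norm_sq_le_re_inner hz.posDef_A.1
      coercive_schur x y hxy := by
        rw [← map_add, ← inner_add_right, ← complexLin_schur_apply hdet hxy]
        refine le_trans ?_ (lamMin_mul_norm_sq_le_re_inner hz.posDef_schur.1 x)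
        gcongr
        exact min_le_right _ _
      mu_pos := hμ
      mux_pos := lt_min hL (lamMin_pos hn hz.posDef_schur)
      mux_le := min_le_left _ _ }

lemma IsEigDecomp.exists_eigenvector {ι : Type*} [Fintype ι] [DecidableEq ι] {M : Matrix ι ι ℝ}
    {Q : Matrix ι ι ℂ} {ev : ι → ℂ} (hQ : IsEigDecomp M Q ev) (i : ι) :
    ∃ w : ι → ℂ, w ≠ 0 ∧ M.map (fun a : ℝ => (a : ℂ)) *ᵥ w = ev i • w := by
  have hQw : Q *ᵥ Q⁻¹ *ᵥ Pi.single i 1 = Pi.single i 1 := by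
    rw [mulVec_mulVec, mul_nonsing_inv _ hQ.1, one_mulVec]
  refine ⟨Q⁻¹ *ᵥ Pi.single i 1, fun h0 => ?_, ?_⟩
  · rw [h0, mulVec_zero] at hQw
    simpa using congrFun hQw i
  · rw [hQ.2, ← mulVec_mulVec, hQw, ← mulVec_mulVec, diagonal_mulVec_single, mul_one,
      ← mulVec_smul, ← Pi.single_smul, smul_eq_mul, mul_one]

lemma matM_map_mulVec (w : Fin n ⊕ Fin m → ℂ) :
    (matM f zs r).map (fun a : ℝ => (a : ℂ)) *ᵥ w =
      Sum.elim
        (-complexLin (blockC f zs) (WithLp.toLp 2 (w ∘ Sum.inl)) -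
          complexLin (blockB f zs) (WithLp.toLp 2 (w ∘ Sum.inr)))
        ((r : ℂ) • (complexLin (blockB f zs)ᵀ (WithLp.toLp 2 (w ∘ Sum.inl)) -
          complexLin (blockA f zs) (WithLp.toLp 2 (w ∘ Sum.inr)))) := by
  rw [matM, fromBlocks_map, fromBlocks_mulVec]
  ext (j | j) <;>
    simp [complexLin, mulVec, dotProduct, sub_eq_add_neg, Finset.mul_sum, mul_assoc]

lemma IsEigDecomp.exists_isEigenpair {Q : Matrix (Fin n ⊕ Fin m) (Fin n ⊕ Fin m) ℂ}
    {ev : Fin n ⊕ Fin m → ℂ} (hQ : IsEigDecomp (matM f zs r) Q ev) (i : Fin n ⊕ Fin m) :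
    ∃ u v, IsEigenpair (complexLin (blockA f zs)) (complexLin (blockB f zs))
      (complexLin (blockB f zs)ᵀ) (complexLin (blockC f zs)) r (ev i) u v := by
  obtain ⟨w, hw0, hw⟩ := hQ.exists_eigenvector i
  rw [matM_map_mulVec] at hw
  refine ⟨WithLp.toLp 2 (w ∘ Sum.inl), WithLp.toLp 2 (w ∘ Sum.inr), ?_, ?_, ?_⟩
  · ext j
    exact (congrFun hw (Sum.inl j)).symm
  · ext j
    exact (congrFun hw (Sum.inr j)).symm
  · contrapose! hw0
    ext j
    rcases j with j | j
    · exact congrArg (fun x : EuclideanSpace ℂ (Fin n) => x j) hw0.1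
    · exact congrArg (fun x : EuclideanSpace ℂ (Fin m) => x j) hw0.2

end Stackelberg

end Matrices

section ContractionFactors

lemma contraction_factors_of_real {a q : ℝ} (hq : 0 ≤ q) (hq1 : q ≤ 1) (ha : -(1 / 4) ≤ a)
    (haq : a ≤ -(q / 4)) : |a| ≤ 1 ∧ |1 + a| ≤ 1 - q / 32 ∧ |1 + a + a ^ 2| ≤ 1 - q / 32 := by
  have hsq : a ^ 2 ≤ -(a / 4) := by nlinarith
  refine ⟨abs_le.2 ⟨?_, ?_⟩, abs_le.2 ⟨?_, ?_⟩, abs_le.2 ⟨?_, ?_⟩⟩ <;> linarith [sq_nonneg a]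

lemma norm_le_one_sub_of_sq_le {z : ℂ} {t : ℝ} (ht : t ≤ 1) (h : ‖z‖ ^ 2 ≤ 1 - 2 * t) :
    ‖z‖ ≤ 1 - t :=
  le_of_sq_le_sq (by linarith [sq_nonneg t]) (sub_nonneg.2 ht)

lemma contraction_factors_of_norm_sq_le {x : ℂ} {s : ℝ} (hs : s ≤ 1 / 2) (hre : x.re ≤ -(s / 8))
    (hx : ‖x‖ ^ 2 ≤ 3 * s / 16) :
    ‖x‖ ≤ 1 ∧ ‖1 + x‖ ≤ 1 - s / 32 ∧ ‖1 + x + x ^ 2‖ ≤ 1 - s / 32 := by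
  have hs0 : 0 ≤ s := by linarith [sq_nonneg ‖x‖]
  have hre_sq : x.re ^ 2 ≤ ‖x‖ ^ 2 := by
    rw [Complex.sq_norm, Complex.normSq_apply]
    linarith [mul_self_nonneg x.im]
  have hre_ge : -(1 / 3) ≤ x.re := by nlinarith
  refine ⟨?_, norm_le_one_sub_of_sq_le (by linarith) ?_,
    norm_le_one_sub_of_sq_le (by linarith) ?_⟩
  · exact le_of_sq_le_sq (by linarith) zero_le_one
  · have : ‖1 + x‖ ^ 2 = 1 + 2 * x.re + ‖x‖ ^ 2 := by
      simp only [Complex.sq_norm, Complex.normSq_apply, Complex.add_re, Complex.one_re,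
        Complex.add_im, Complex.one_im]
      ring
    linarith
  · have : ‖1 + x + x ^ 2‖ ^ 2 =
        1 + 2 * x.re + 4 * x.re ^ 2 - ‖x‖ ^ 2 + ‖x‖ ^ 2 * (2 * x.re + ‖x‖ ^ 2) := by
      simp only [Complex.sq_norm, Complex.normSq_apply, Complex.add_re, Complex.one_re,
        Complex.add_im, Complex.one_im, pow_two x, Complex.mul_re, Complex.mul_im]
      ring
    have hneg : ‖x‖ ^ 2 * (2 * x.re + ‖x‖ ^ 2) ≤ 0 :=
      mul_nonpos_of_nonneg_of_nonpos (sq_nonneg _) (by linarith)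
    have : x.re * (1 + 3 * x.re) ≤ 0 :=
      mul_nonpos_of_nonpos_of_nonneg (by linarith) (by linarith)
    linarith

/-- The three factors are those by which a half step, a step of gradient descent ascent and a step
of extra-gradient act on an eigenvector. -/
lemma StackelbergBlocks.contraction_factors {X Y : Type*} [NormedAddCommGroup X]
    [InnerProductSpace ℂ X] [NormedAddCommGroup Y] [InnerProductSpace ℂ Y]
    {A : Y →ₗ[ℂ] Y} {B : Y →ₗ[ℂ] X} {B' : X →ₗ[ℂ] Y} {C : X →ₗ[ℂ] X} {L μ μx r : ℝ} {z x : ℂ}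
    {u : X} {v : Y} (h : StackelbergBlocks A B B' C L μ μx) (hz : IsEigenpair A B B' C r z u v)
    (hr : 2 ≤ r) (hrμ : 2 * L ≤ r * μ) (hx : x = (1 / (4 * r * L) : ℝ) * z) :
    ‖x‖ ≤ 1 ∧ ‖1 + x‖ ≤ 1 - μx / (r * L) / 32 ∧ ‖1 + x + x ^ 2‖ ≤ 1 - μx / (r * L) / 32 := by
  have hr0 : 0 < r := by linarith
  have hL := h.L_pos
  have hμx := h.mux_pos
  have hqs : μx / (r * L) ≤ 1 / r := by
    rw [div_le_div_iff₀ (by positivity) hr0]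
    linarith [mul_le_mul_of_nonneg_left h.mux_le hr0.le]
  have hs : 1 / r ≤ 1 / 2 := one_div_le_one_div_of_le two_pos hr
  have hre : x.re = z.re / (4 * r * L) := by rw [hx, Complex.re_ofReal_mul]; ring
  rcases h.eigenvalue_bounds hz hr hrμ with ⟨him, hlow, hup⟩ | ⟨hup, hnorm⟩
  · have hx_real : x = (x.re : ℝ) := by
      refine Complex.ext rfl ?_
      rw [hx, Complex.im_ofReal_mul, Complex.ofReal_im]
      exact mul_eq_zero_of_right _ him
    have hlow' : -(1 / 4) ≤ x.re := by
      rw [hre, le_div_iff₀ (by positivity)]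
      exact le_trans (by linarith) hlow
    have hup' : x.re ≤ -(μx / (r * L) / 4) := by
      have : -(μx / (r * L) / 4) = -μx / (4 * r * L) := by ring
      rw [hre, this]
      gcongr
      exact hup
    rw [hx_real]
    exact_mod_cast contraction_factors_of_real (by positivity) (by linarith) hlow' hup'
  · have hup' : x.re ≤ -(1 / r / 8) := by
      have : -(1 / r / 8) = -(L / 2) / (4 * r * L) := by field_simp; norm_num
      rw [hre, this]
      gcongr
      exact hup
    have hnorm' : ‖x‖ ^ 2 ≤ 3 * (1 / r) / 16 := by
      have : 3 * (1 / r) / 16 = (1 / (4 * r * L)) ^ 2 * (3 * r * L ^ 2) := by field_simp; norm_num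
      rw [hx, norm_mul, mul_pow, Complex.norm_real, Real.norm_eq_abs, sq_abs, this]
      gcongr
    obtain ⟨h₀, h₁, h₂⟩ := contraction_factors_of_norm_sq_le hs hup' hnorm'
    exact ⟨h₀, by linarith, by linarith⟩

end ContractionFactors

section EigenbasisNorm

open Matrix Polynomial

variable {ι : Type*} [Fintype ι]

/-- A real vector, viewed as a complex vector. -/
noncomputable def complexify : EuclideanSpace ℝ ι →ₗᵢ[ℝ] EuclideanSpace ℂ ι where
  toFun e := WithLp.toLp 2 fun i => (e i : ℂ)
  map_add' e e' := by ext i; simp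
  map_smul' c e := by ext i; simp
  norm_map' e := by simp [EuclideanSpace.norm_eq]

variable [DecidableEq ι]

lemma complexify_toEuclideanLin (M : Matrix ι ι ℝ) (e : EuclideanSpace ℝ ι) :
    complexify (toEuclideanLin M e) = complexLin M (complexify e) := by
  ext j
  simp [complexify, complexLin, toLpLin_apply, mulVec, dotProduct]

/-- The coordinates `P e` of a real vector `e` in the basis of the columns of `P⁻¹`. -/
noncomputable def eigCoord (Q : Matrix ι ι ℂ) : EuclideanSpace ℝ ι →ₗ[ℝ] EuclideanSpace ℂ ι :=
  (toEuclideanLin Q).restrictScalars ℝ ∘ₗ complexify.toLinearMap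

/-- The norm `‖P e‖` of the coordinates of `e` in an eigenbasis, for which the linearized dynamics
is contracting. -/
noncomputable def eigNorm (Q : Matrix ι ι ℂ) : Seminorm ℝ (EuclideanSpace ℝ ι) :=
  (normSeminorm ℝ (EuclideanSpace ℂ ι)).comp (eigCoord Q)

variable {M : Matrix ι ι ℝ} {Q : Matrix ι ι ℂ} {ev : ι → ℂ}

lemma eigNorm_le (e : EuclideanSpace ℝ ι) : eigNorm Q e ≤ specNorm Q * ‖e‖ :=
  (norm_toEuclideanLin_le Q (complexify e)).trans_eq (by rw [LinearIsometry.norm_map])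

lemma norm_le_eigNorm (hQ : IsUnit Q.det) (e : EuclideanSpace ℝ ι) :
    ‖e‖ ≤ specNorm Q⁻¹ * eigNorm Q e := by
  have hinv : toEuclideanLin Q⁻¹ (eigCoord Q e) = complexify e := by
    change toEuclideanLin Q⁻¹ (toEuclideanLin Q (complexify e)) = complexify e
    rw [← LinearMap.comp_apply, ← toLpLin_mul_same, nonsing_inv_mul _ hQ, toLpLin_one,
      LinearMap.id_apply]
  rw [← complexify.norm_map, ← hinv]
  exact norm_toEuclideanLin_le _ _

lemma specNorm_inv_mul_eigNorm_le (e : EuclideanSpace ℝ ι) :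
    specNorm Q⁻¹ * eigNorm Q e ≤ condNum Q * ‖e‖ := by
  rw [condNum, mul_comm (specNorm Q), mul_assoc]
  exact mul_le_mul_of_nonneg_left (eigNorm_le e) (specNorm_nonneg _)

lemma IsEigDecomp.smul (hQ : IsEigDecomp M Q ev) (c : ℝ) :
    IsEigDecomp (c • M) Q fun i => c * ev i := by
  refine ⟨hQ.1, ?_⟩
  have hdiag : diagonal (fun i => (c : ℂ) * ev i) = (c : ℂ) • diagonal ev := by
    rw [← diagonal_smul]; rfl
  have hmap : (c • M).map (fun a : ℝ => (a : ℂ)) = (c : ℂ) • M.map fun a : ℝ => (a : ℂ) := by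
    ext; simp
  rw [hdiag, hmap, hQ.2, Matrix.mul_smul, Matrix.smul_mul]

lemma IsEigDecomp.eigCoord_apply (hQ : IsEigDecomp M Q ev) (e : EuclideanSpace ℝ ι) (i : ι) :
    eigCoord Q (toEuclideanLin M e) i = ev i * eigCoord Q e i := by
  change toEuclideanLin Q (complexify (toEuclideanLin M e)) i = _
  rw [complexify_toEuclideanLin, complexLin, hQ.2, ← LinearMap.comp_apply, ← toLpLin_mul_same,
    ← mul_assoc, ← mul_assoc, mul_nonsing_inv _ hQ.1, one_mul, toLpLin_mul_same]
  exact mulVec_diagonal ev _ i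

lemma IsEigDecomp.eigCoord_aeval (hQ : IsEigDecomp M Q ev) (p : ℝ[X]) (e : EuclideanSpace ℝ ι)
    (i : ι) :
    eigCoord Q (aeval (toEuclideanLin M) p e) i = aeval (ev i) p * eigCoord Q e i := by
  induction p using Polynomial.induction_on generalizing e with
  | C a => simp
  | add p q hp hq => simp only [map_add, LinearMap.add_apply, PiLp.add_apply, hp, hq, add_mul]
  | monomial k a ih =>
    rw [pow_succ, ← mul_assoc, map_mul _ _ X, map_mul _ _ X, aeval_X, aeval_X,
      Module.End.mul_apply, ih, hQ.eigCoord_apply, mul_assoc]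

lemma eigNorm_aeval_le (hQ : IsEigDecomp M Q ev) (p : ℝ[X]) {c : ℝ} (hc : 0 ≤ c)
    (hp : ∀ i, ‖aeval (ev i) p‖ ≤ c) (e : EuclideanSpace ℝ ι) :
    eigNorm Q (aeval (toEuclideanLin M) p e) ≤ c * eigNorm Q e := by
  change ‖eigCoord Q _‖ ≤ c * ‖eigCoord Q e‖
  refine le_of_sq_le_sq ?_ (by positivity)
  rw [mul_pow, EuclideanSpace.norm_sq_eq, EuclideanSpace.norm_sq_eq, Finset.mul_sum]
  gcongr with i
  rw [hQ.eigCoord_aeval, norm_mul, mul_pow]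
  gcongr
  exact hp i

lemma eigNorm_apply_le (hQ : IsEigDecomp M Q ev) {c : ℝ} (hc : 0 ≤ c) (h : ∀ i, ‖ev i‖ ≤ c)
    (e : EuclideanSpace ℝ ι) : eigNorm Q (toEuclideanLin M e) ≤ c * eigNorm Q e := by
  simpa only [aeval_X] using eigNorm_aeval_le hQ X hc (by simpa only [aeval_X] using h) e

lemma eigNorm_add_apply_le (hQ : IsEigDecomp M Q ev) {c : ℝ} (hc : 0 ≤ c)
    (h : ∀ i, ‖1 + ev i‖ ≤ c) (e : EuclideanSpace ℝ ι) :
    eigNorm Q (e + toEuclideanLin M e) ≤ c * eigNorm Q e := by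
  have heval : aeval (toEuclideanLin M) (1 + X : ℝ[X]) e = e + toEuclideanLin M e := by simp
  rw [← heval]
  exact eigNorm_aeval_le hQ _ hc (by simpa using h) e

lemma eigNorm_add_apply_add_apply_apply_le (hQ : IsEigDecomp M Q ev) {c : ℝ} (hc : 0 ≤ c)
    (h : ∀ i, ‖1 + ev i + ev i ^ 2‖ ≤ c) (e : EuclideanSpace ℝ ι) :
    eigNorm Q (e + toEuclideanLin M e + toEuclideanLin M (toEuclideanLin M e)) ≤
      c * eigNorm Q e := by
  have heval : aeval (toEuclideanLin M) (1 + X + X ^ 2 : ℝ[X]) e =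
      e + toEuclideanLin M e + toEuclideanLin M (toEuclideanLin M e) := by simp [pow_two]
  rw [← heval]
  exact eigNorm_aeval_le hQ _ hc (by simpa using h) e

end EigenbasisNorm

section Dynamics

lemma le_geometric_add_sum {a w : ℕ → ℝ} {ρ : ℝ} {T : ℕ} (ha : 0 ≤ a 0) (hw : ∀ k, 0 ≤ w k)
    (hρ₀ : 0 ≤ ρ) (hρ₁ : ρ ≤ 1)
    (hstep : ∀ k < T, a k + w k ≤ a 0 + ∑ j ∈ Finset.range T, w j → a (k + 1) ≤ ρ * a k + w k) :
    ∀ k ≤ T, a k ≤ ρ ^ k * a 0 + ∑ j ∈ Finset.range k, w j := by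
  intro k
  induction k with
  | zero => simp
  | succ k ih =>
    intro hk
    have hak := ih (by lia)
    have hsum : ∑ j ∈ Finset.range k, w j + w k ≤ ∑ j ∈ Finset.range T, w j := by
      rw [← Finset.sum_range_succ]
      exact Finset.sum_le_sum_of_subset_of_nonneg (Finset.range_mono hk) fun i _ _ => hw i
    have hpow : ρ ^ k * a 0 ≤ a 0 := mul_le_of_le_one_left ha (pow_le_one₀ hρ₀ hρ₁)
    have hdamp : ρ * ∑ j ∈ Finset.range k, w j ≤ ∑ j ∈ Finset.range k, w j :=
      mul_le_of_le_one_left (Finset.sum_nonneg fun i _ => hw i) hρ₁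
    calc a (k + 1) ≤ ρ * a k + w k := hstep k (by lia) (by linarith)
      _ ≤ ρ * (ρ ^ k * a 0 + ∑ j ∈ Finset.range k, w j) + w k := by gcongr
      _ ≤ ρ ^ (k + 1) * a 0 + ∑ j ∈ Finset.range (k + 1), w j := by
        rw [Finset.sum_range_succ, pow_succ]
        linarith

lemma sum_range_pairs {M : Type*} [AddCommMonoid M] (x : ℕ → M) (T : ℕ) :
    ∑ k ∈ Finset.range T, (x (2 * k) + x (2 * k + 1)) = ∑ j ∈ Finset.range (2 * T), x j := by
  induction T with
  | zero => simp
  | succ T ih =>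
    rw [Finset.sum_range_succ, ih, mul_add, mul_one, Finset.sum_range_succ, Finset.sum_range_succ,
      add_assoc]

/-- Within distance `δ` of `zs`, the update direction `D ∘ F` is a small perturbation of a linear
field `G` whose gradient steps `e + G e` and extra-gradient steps `e + G e + G (G e)` contract the
seminorm `N` by the factor `1 - θ`; the constants `c` and `h` compare `N` with the norm. -/
structure LocallyContracting {E : Type*} [NormedAddCommGroup E] [Module ℝ E]
    (F : E → E) (D G : E →ₗ[ℝ] E) (N : Seminorm ℝ E) (zs : E) (c h δ θ : ℝ) : Prop where
  c_nonneg : 0 ≤ c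
  h_nonneg : 0 ≤ h
  theta_nonneg : 0 ≤ θ
  theta_le_one : θ ≤ 1
  norm_le : ∀ e, ‖e‖ ≤ c * N e
  apply_D_le : ∀ e, N (D e) ≤ h * ‖e‖
  apply_G_le : ∀ e, N (G e) ≤ N e
  one_add_le : ∀ e, N (e + G e) ≤ (1 - θ) * N e
  one_add_sq_le : ∀ e, N (e + G e + G (G e)) ≤ (1 - θ) * N e
  remainder_le : ∀ z, ‖z - zs‖ ≤ δ → N (D (F z) - G (z - zs)) ≤ θ / 4 * N (z - zs)

namespace LocallyContracting

variable {E : Type*} [NormedAddCommGroup E] [Module ℝ E] {F : E → E} {D G : E →ₗ[ℝ] E}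
  {N : Seminorm ℝ E} {zs : E} {c h δ θ : ℝ}

lemma gradient_step_le (H : LocallyContracting F D G N zs c h δ θ) {z ξ : E}
    (hz : ‖z - zs‖ ≤ δ) :
    N (z + D (F z + ξ) - zs) ≤ (1 - θ / 2) * N (z - zs) + h * ‖ξ‖ := by
  have hsplit : z + D (F z + ξ) - zs = (z - zs + G (z - zs)) + (D (F z) - G (z - zs)) + D ξ := by
    rw [map_add]
    abel
  calc N (z + D (F z + ξ) - zs)
      ≤ N (z - zs + G (z - zs)) + N (D (F z) - G (z - zs)) + N (D ξ) := by
        rw [hsplit]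
        exact (map_add_le_add N _ _).trans (by gcongr; exact map_add_le_add N _ _)
    _ ≤ (1 - θ) * N (z - zs) + θ / 4 * N (z - zs) + h * ‖ξ‖ := by
        gcongr
        exacts [H.one_add_le _, H.remainder_le z hz, H.apply_D_le ξ]
    _ ≤ (1 - θ / 2) * N (z - zs) + h * ‖ξ‖ := by
        linarith [mul_nonneg H.theta_nonneg (apply_nonneg N (z - zs))]

lemma gradient_step_le_add (H : LocallyContracting F D G N zs c h δ θ) {z ξ : E}
    (hz : ‖z - zs‖ ≤ δ) : N (z + D (F z + ξ) - zs) ≤ N (z - zs) + h * ‖ξ‖ := by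
  linarith [H.gradient_step_le (ξ := ξ) hz, mul_nonneg H.theta_nonneg (apply_nonneg N (z - zs))]

lemma extragradient_step_le (H : LocallyContracting F D G N zs c h δ θ) {z z' ξ ξ' : E}
    (hz : ‖z - zs‖ ≤ δ) (hz' : ‖z' - zs‖ ≤ δ) (hzz' : z' = z + D (F z + ξ)) :
    N (z + D (F z' + ξ') - zs) ≤ (1 - θ / 2) * N (z - zs) + h * (2 * ‖ξ‖ + ‖ξ'‖) := by
  have hsplit : z + D (F z' + ξ') - zs =
      (z - zs + G (z - zs) + G (G (z - zs))) + G (D (F z) - G (z - zs)) + G (D ξ) +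
        (D (F z') - G (z' - zs)) + D ξ' := by
    have : z' - zs = (z - zs) + D (F z) + D ξ := by rw [hzz', map_add]; abel
    rw [this]
    simp only [map_add, map_sub]
    abel
  have hθ := H.theta_nonneg
  have hθ1 := H.theta_le_one
  have hξ : 0 ≤ h * ‖ξ‖ := mul_nonneg H.h_nonneg (norm_nonneg ξ)
  have hmid : N (z' - zs) ≤ N (z - zs) + h * ‖ξ‖ := hzz' ▸ H.gradient_step_le_add hz
  calc N (z + D (F z' + ξ') - zs)
      ≤ N (z - zs + G (z - zs) + G (G (z - zs))) + N (G (D (F z) - G (z - zs))) + N (G (D ξ)) +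
          N (D (F z') - G (z' - zs)) + N (D ξ') := by
        rw [hsplit]
        refine (map_add_le_add N _ _).trans (add_le_add_left ?_ _)
        refine (map_add_le_add N _ _).trans (add_le_add_left ?_ _)
        refine (map_add_le_add N _ _).trans (add_le_add_left ?_ _)
        exact map_add_le_add N _ _
    _ ≤ (1 - θ) * N (z - zs) + θ / 4 * N (z - zs) + h * ‖ξ‖ +
          θ / 4 * (N (z - zs) + h * ‖ξ‖) + h * ‖ξ'‖ := by
        gcongr
        · exact H.one_add_sq_le _
        · exact (H.apply_G_le _).trans (H.remainder_le z hz)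
        · exact (H.apply_G_le _).trans (H.apply_D_le ξ)
        · exact (H.remainder_le z' hz').trans (by gcongr)
        · exact H.apply_D_le ξ'
    _ ≤ (1 - θ / 2) * N (z - zs) + h * (2 * ‖ξ‖ + ‖ξ'‖) := by
        linarith [mul_le_of_le_one_left hξ (by linarith : θ / 4 ≤ 1)]

lemma norm_le_of_apply_le (H : LocallyContracting F D G N zs c h δ θ) {e : E} {R : ℝ}
    (hR : c * R ≤ δ) (he : N e ≤ R) : ‖e‖ ≤ δ :=
  (H.norm_le e).trans ((mul_le_mul_of_nonneg_left he H.c_nonneg).trans hR)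

lemma norm_le_of_apply_le_pow_mul_add (H : LocallyContracting F D G N zs c h δ θ) {e e₀ : E}
    {d w : ℝ} {T : ℕ} (hd : c * N e₀ ≤ d) (he : N e ≤ (1 - θ / 2) ^ T * N e₀ + w) :
    ‖e‖ ≤ (1 - θ / 2) ^ T * d + c * w := by
  have hρ : 0 ≤ 1 - θ / 2 := by linarith [H.theta_le_one]
  calc ‖e‖ ≤ c * ((1 - θ / 2) ^ T * N e₀ + w) :=
        (H.norm_le e).trans (mul_le_mul_of_nonneg_left he H.c_nonneg)
    _ = (1 - θ / 2) ^ T * (c * N e₀) + c * w := by ring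
    _ ≤ (1 - θ / 2) ^ T * d + c * w := by gcongr

lemma norm_gradient_iterate_sub_le (H : LocallyContracting F D G N zs c h δ θ) {z ξ : ℕ → E}
    {T : ℕ} {d : ℝ} (hz : ∀ k, z (k + 1) = z k + D (F (z k) + ξ k)) (hd : c * N (z 0 - zs) ≤ d)
    (hδ : d + c * (h * ∑ j ∈ Finset.range T, ‖ξ j‖) ≤ δ) :
    ‖z T - zs‖ ≤ (1 - θ / 2) ^ T * d + c * (h * ∑ j ∈ Finset.range T, ‖ξ j‖) := by
  have hh := H.h_nonneg
  refine H.norm_le_of_apply_le_pow_mul_add hd ?_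
  rw [Finset.mul_sum] at hδ ⊢
  refine le_geometric_add_sum (a := fun k => N (z k - zs)) (apply_nonneg N _)
    (fun k => by positivity) (by linarith [H.theta_le_one]) (by linarith [H.theta_nonneg])
    (fun k _ hk => ?_) T le_rfl
  have hball : c * (N (z 0 - zs) + ∑ j ∈ Finset.range T, h * ‖ξ j‖) ≤ δ := by linarith
  have hξ : 0 ≤ h * ‖ξ k‖ := by positivity
  rw [hz]
  exact H.gradient_step_le (H.norm_le_of_apply_le hball (by linarith))

lemma norm_extragradient_iterate_sub_le (H : LocallyContracting F D G N zs c h δ θ)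
    {z z' ξ : ℕ → E} {T : ℕ} {d : ℝ} (hz' : ∀ k, z' k = z k + D (F (z k) + ξ (2 * k)))
    (hz : ∀ k, z (k + 1) = z k + D (F (z' k) + ξ (2 * k + 1))) (hd : c * N (z 0 - zs) ≤ d)
    (hδ : d + c * (2 * h * ∑ j ∈ Finset.range (2 * T), ‖ξ j‖) ≤ δ) :
    ‖z T - zs‖ ≤
      (1 - θ / 2) ^ T * d + c * (2 * h * ∑ j ∈ Finset.range (2 * T), ‖ξ j‖) := by
  have hh := H.h_nonneg
  set w : ℕ → ℝ := fun k => h * (2 * ‖ξ (2 * k)‖ + ‖ξ (2 * k + 1)‖) with hw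
  have hsum : ∑ k ∈ Finset.range T, w k ≤ 2 * h * ∑ j ∈ Finset.range (2 * T), ‖ξ j‖ := by
    rw [← sum_range_pairs, Finset.mul_sum]
    gcongr with k
    have : 0 ≤ h * ‖ξ (2 * k + 1)‖ := by positivity
    linarith [congrFun hw k]
  have hball : c * (N (z 0 - zs) + 2 * h * ∑ j ∈ Finset.range (2 * T), ‖ξ j‖) ≤ δ := by linarith
  refine H.norm_le_of_apply_le_pow_mul_add hd ?_
  refine (le_geometric_add_sum (a := fun k => N (z k - zs)) (w := w) (ρ := 1 - θ / 2)
    (apply_nonneg N _) (fun k => by positivity) (by linarith [H.theta_le_one])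
    (by linarith [H.theta_nonneg]) (fun k _ hk => ?_) T le_rfl).trans (by gcongr)
  have hξ : 0 ≤ h * ‖ξ (2 * k)‖ := by positivity
  have hξ' : 0 ≤ h * ‖ξ (2 * k + 1)‖ := by positivity
  have hzδ : ‖z k - zs‖ ≤ δ := H.norm_le_of_apply_le hball (by linarith [congrFun hw k])
  have hz'δ : ‖z' k - zs‖ ≤ δ := by
    refine H.norm_le_of_apply_le hball ?_
    rw [hz']
    linarith [congrFun hw k, H.gradient_step_le_add (ξ := ξ (2 * k)) hzδ]
  rw [hz]
  exact H.extragradient_step_le hzδ hz'δ (hz' k)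

end LocallyContracting

lemma one_sub_pow_mul_le {t d ε ℓ : ℝ} {T : ℕ} (hε : 0 < ε) (hd : 0 < d) (ht : t ≤ 1)
    (hℓ : 1 ≤ ℓ) (hlog : Real.log (d / ε) ≤ ℓ) (hT : 2 * ℓ ≤ t * T) :
    (1 - t) ^ T * d ≤ ε / 2 := by
  have hexp : (1 - t) ^ T ≤ Real.exp (-(t * T)) := by
    calc (1 - t) ^ T ≤ Real.exp (-t) ^ T := by
          exact pow_le_pow_left₀ (by linarith) (by linarith [Real.add_one_le_exp (-t)]) T
      _ = Real.exp (-(t * T)) := by rw [← Real.exp_nat_mul]; ring_nf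
  have hlog2 : Real.log 2 ≤ 1 := by linarith [Real.log_two_lt_d9]
  calc (1 - t) ^ T * d ≤ Real.exp (-Real.log (2 * (d / ε))) * d := by
        gcongr
        refine hexp.trans (Real.exp_le_exp.2 (neg_le_neg ?_))
        rw [Real.log_mul two_ne_zero (by positivity)]
        linarith
    _ = ε / 2 := by
        rw [Real.exp_neg, Real.exp_log (by positivity)]
        field_simp

lemma one_sub_inv_pow_ceil_mul_le {κ d ε ℓ : ℝ} (hε : 0 < ε) (hd : 0 < d) (hκ : 1 ≤ κ)
    (hℓ : 1 ≤ ℓ) (hlog : Real.log (d / ε) ≤ ℓ) :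
    (1 - 1 / (32 * κ) / 2) ^ ⌈128 * (κ * ℓ)⌉₊ * d ≤ ε / 2 := by
  have hrate : 1 / (32 * κ) / 2 ≤ 1 := by
    rw [div_div]
    exact (div_le_one (by positivity)).2 (by linarith)
  refine one_sub_pow_mul_le hε hd hrate hℓ hlog ?_
  calc 2 * ℓ = 1 / (32 * κ) / 2 * (128 * (κ * ℓ)) := by field_simp; norm_num
    _ ≤ 1 / (32 * κ) / 2 * ⌈128 * (κ * ℓ)⌉₊ := by
      gcongr
      exact Nat.le_ceil _

end Dynamics

section Parts

variable {n m : ℕ}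

@[simp] lemma xPart_apply (z : Pt n m) (i : Fin n) : xPart z i = z (Sum.inl i) := rfl

@[simp] lemma yPart_apply (z : Pt n m) (j : Fin m) : yPart z j = z (Sum.inr j) := rfl

@[simp] lemma mkPt_inl (x : EuclideanSpace ℝ (Fin n)) (y : EuclideanSpace ℝ (Fin m)) (i : Fin n) :
    mkPt x y (Sum.inl i) = x i := rfl

@[simp] lemma mkPt_inr (x : EuclideanSpace ℝ (Fin n)) (y : EuclideanSpace ℝ (Fin m)) (j : Fin m) :
    mkPt x y (Sum.inr j) = y j := rfl

lemma norm_sq_eq_xPart_add_yPart (z : Pt n m) : ‖z‖ ^ 2 = ‖xPart z‖ ^ 2 + ‖yPart z‖ ^ 2 := by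
  simp [EuclideanSpace.norm_sq_eq]

lemma eq_zero_of_xPart_of_yPart {z : Pt n m} (hx : xPart z = 0) (hy : yPart z = 0) : z = 0 := by
  simpa [hx, hy] using norm_sq_eq_xPart_add_yPart z

end Parts

section Linearization

open Matrix Filter Topology Polynomial

variable {n m : ℕ} {f : Pt n m → ℝ} {zs : Pt n m} {L r : ℝ}

lemma eventually_differentiableAt_and_differentiableAt_fderiv {E F : Type*} [NormedAddCommGroup E]
    [NormedSpace ℝ E] [NormedAddCommGroup F] [NormedSpace ℝ F] {f : E → F} {x : E}
    (hf : ContDiffAt ℝ 2 f x) :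
    (∀ᶠ y in 𝓝 x, DifferentiableAt ℝ f y) ∧ DifferentiableAt ℝ (fderiv ℝ f) x :=
  ⟨(hf.eventually (by simp)).mono fun _ h => h.differentiableAt two_ne_zero,
    (hf.fderiv_right (m := 1) (by norm_num)).differentiableAt one_ne_zero⟩

lemma hessian_isSymm (hf : ∀ᶠ z in 𝓝 zs, DifferentiableAt ℝ f z)
    (hf' : DifferentiableAt ℝ (fderiv ℝ f) zs) : (hessian f zs).IsSymm := by
  ext i j
  exact second_derivative_symmetric_of_eventually (hf.mono fun _ hz => hz.hasFDerivAt)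
    hf'.hasFDerivAt _ _

lemma hasFDerivAt_gradient (hf : ∀ᶠ z in 𝓝 zs, DifferentiableAt ℝ f z)
    (hf' : DifferentiableAt ℝ (fderiv ℝ f) zs) :
    HasFDerivAt (gradient f) (toEuclideanLin (hessian f zs)).toContinuousLinearMap zs := by
  refine (((InnerProductSpace.toDual ℝ
    (Pt n m)).symm.toContinuousLinearEquiv.toContinuousLinearMap).hasFDerivAt.comp zs
      hf'.hasFDerivAt).congr_fderiv ?_
  ext e i
  have hcoord : ((InnerProductSpace.toDual ℝ (Pt n m)).symm (fderiv ℝ (fderiv ℝ f) zs e)) i =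
      fderiv ℝ (fderiv ℝ f) zs e (EuclideanSpace.single i 1) := by
    rw [← InnerProductSpace.toDual_symm_apply, EuclideanSpace.inner_single_right]
    simp
  have hbasis : e = ∑ j, e j • EuclideanSpace.single j (1 : ℝ) := by
    simpa using ((EuclideanSpace.basisFun (Fin n ⊕ Fin m) ℝ).sum_repr e).symm
  have hsum : toEuclideanLin (hessian f zs) e i =
      ∑ j, e j * fderiv ℝ (fderiv ℝ f) zs (EuclideanSpace.single j 1)
        (EuclideanSpace.single i 1) := by
    simp only [toLpLin_apply, mulVec, dotProduct]
    exact Finset.sum_congr rfl fun j _ => by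
      rw [← (hessian_isSymm hf hf').apply i j, hessian, of_apply, mul_comm]
  refine hcoord.trans ?_
  rw [LinearMap.coe_toContinuousLinearMap', hsum]
  conv_lhs => rw [hbasis]
  simp

lemma exists_forall_seminorm_remainder_le {E : Type*} [NormedAddCommGroup E] [NormedSpace ℝ E]
    {F : E → E} {H : E →L[ℝ] E} {D : E →ₗ[ℝ] E} {N : Seminorm ℝ E} {zs : E} {c h t : ℝ}
    (hF : HasFDerivAt F H zs) (hF₀ : F zs = 0) (hc : 0 ≤ c) (hh : 0 ≤ h)
    (hN : ∀ e, ‖e‖ ≤ c * N e) (hD : ∀ e, N (D e) ≤ h * ‖e‖) (ht : 0 < t) :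
    ∃ δ > 0, ∀ z, ‖z - zs‖ ≤ δ → N (D (F z) - D (H (z - zs))) ≤ t * N (z - zs) := by
  have ht' : 0 < t / (h * c + 1) := by positivity
  obtain ⟨δ, hδ, hball⟩ :=
    Metric.nhds_basis_closedBall.eventually_iff.1 (hF.isLittleO.bound ht')
  refine ⟨δ, hδ, fun z hz => ?_⟩
  have hrem := hball (mem_closedBall_iff_norm.2 hz)
  rw [hF₀, sub_zero] at hrem
  have hconst : h * (t / (h * c + 1) * c) ≤ t := by
    have : h * (t / (h * c + 1) * c) = h * c * t / (h * c + 1) := by ring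
    rw [this, div_le_iff₀ (by positivity)]
    linarith
  calc N (D (F z) - D (H (z - zs))) ≤ h * ‖F z - H (z - zs)‖ := by
        rw [← map_sub]
        exact hD _
    _ ≤ h * (t / (h * c + 1) * (c * N (z - zs))) := by
        gcongr
        exact hrem.trans (by gcongr; exact hN _)
    _ = h * (t / (h * c + 1) * c) * N (z - zs) := by ring
    _ ≤ t * N (z - zs) := by gcongr

/-- The update direction `g ↦ (-η_x g_x, η_y g_y)` of descent in `x` and ascent in `y`. -/
noncomputable def updateDir (ηx ηy : ℝ) : Pt n m →ₗ[ℝ] Pt n m where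
  toFun g := mkPt (-(ηx • xPart g)) (ηy • yPart g)
  map_add' g g' := by ext (i | i) <;> simp [mul_add, add_comm]
  map_smul' c g := by ext (i | i) <;> simp [mul_left_comm]

lemma step_eq_add (ηx ηy : ℝ) (z g : Pt n m) : step ηx ηy z g = z + updateDir ηx ηy g := by
  ext (i | i) <;> simp [step, updateDir, sub_eq_add_neg]

lemma norm_updateDir_le {ηx ηy : ℝ} (hx : 0 ≤ ηx) (hxy : ηx ≤ ηy) (g : Pt n m) :
    ‖updateDir ηx ηy g‖ ≤ ηy * ‖g‖ := by
  have hy : 0 ≤ ηy := hx.trans hxy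
  refine le_of_sq_le_sq ?_ (by positivity)
  calc ‖updateDir ηx ηy g‖ ^ 2 = ‖-(ηx • xPart g)‖ ^ 2 + ‖ηy • yPart g‖ ^ 2 :=
        norm_sq_eq_xPart_add_yPart _
    _ = ηx ^ 2 * ‖xPart g‖ ^ 2 + ηy ^ 2 * ‖yPart g‖ ^ 2 := by
        simp only [norm_neg, norm_smul, mul_pow, Real.norm_eq_abs, sq_abs]
    _ ≤ ηy ^ 2 * ‖xPart g‖ ^ 2 + ηy ^ 2 * ‖yPart g‖ ^ 2 := by gcongr
    _ = (ηy * ‖g‖) ^ 2 := by rw [mul_pow, norm_sq_eq_xPart_add_yPart, mul_add]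

lemma updateDir_apply (ηx ηy : ℝ) (g : Pt n m) (i : Fin n ⊕ Fin m) :
    updateDir ηx ηy g i = Sum.elim (fun _ => -ηx) (fun _ => ηy) i * g i := by
  rcases i with i | i <;> simp [updateDir]

lemma smul_matM_eq_diagonal_mul (hsymm : (hessian f zs).IsSymm) (η : ℝ) :
    η • matM f zs r = diagonal (Sum.elim (fun _ => -η) (fun _ => r * η)) * hessian f zs := by
  ext (i | i) (j | j) <;>
    simp [matM, blockA, blockB, blockC, toBlocks₁₁, toBlocks₁₂, toBlocks₂₂, hsymm.apply, mul_assoc,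
      mul_left_comm]

lemma updateDir_hessian (hsymm : (hessian f zs).IsSymm) (η : ℝ) (e : Pt n m) :
    updateDir η (r * η) (toEuclideanLin (hessian f zs) e) =
      toEuclideanLin (η • matM f zs r) e := by
  ext i
  rw [updateDir_apply, smul_matM_eq_diagonal_mul hsymm, toLpLin_mul_same]
  exact (mulVec_diagonal _ _ i).symm

lemma IsDiffStackelberg.gradient_eq_zero (hz : IsDiffStackelberg f zs) : gradient f zs = 0 :=
  eq_zero_of_xPart_of_yPart hz.grad_x hz.grad_y

lemma IsDiffStackelberg.one_le_kappa (hz : IsDiffStackelberg f zs) (hm : 0 < m)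
    (hA : specNorm (blockA f zs) ≤ L) : 1 ≤ kappa f zs L :=
  (one_le_div (lamMin_pos hm hz.posDef_A)).2 (hz.lamMin_blockA_le hm hA)

lemma IsDiffStackelberg.one_le_kappaX (hz : IsDiffStackelberg f zs) (hn : 0 < n) (hL : 0 < L) :
    1 ≤ kappaX f zs L :=
  (one_le_div (lt_min hL (lamMin_pos hn hz.posDef_schur))).2 (min_le_left _ _)

lemma IsDiffStackelberg.contraction_factors (hz : IsDiffStackelberg f zs) (hn : 0 < n) (hm : 0 < m)
    (hA : specNorm (blockA f zs) ≤ L) (hB : specNorm (blockB f zs) ≤ L)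
    (hC : specNorm (blockC f zs) ≤ L) (hr : 2 * kappa f zs L ≤ r)
    {Q : Matrix (Fin n ⊕ Fin m) (Fin n ⊕ Fin m) ℂ} {ev : Fin n ⊕ Fin m → ℂ}
    (hQ : IsEigDecomp (matM f zs r) Q ev) {i : Fin n ⊕ Fin m} {x : ℂ}
    (hx : x = (1 / (4 * r * L) : ℝ) * ev i) :
    ‖x‖ ≤ 1 ∧ ‖1 + x‖ ≤ 1 - 1 / (32 * (r * kappaX f zs L)) ∧
      ‖1 + x + x ^ 2‖ ≤ 1 - 1 / (32 * (r * kappaX f zs L)) := by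
  obtain ⟨u, v, huv⟩ := hQ.exists_isEigenpair i
  have hblocks := hz.stackelbergBlocks hn hm hA hB hC
  have hr₂ : 2 ≤ r := by linarith [hz.one_le_kappa hm hA]
  have hrμ : 2 * L ≤ r * lamMin (blockA f zs) := by
    rwa [kappa, ← mul_div_assoc, div_le_iff₀ hblocks.mu_pos] at hr
  have hrate : min L (lamMin (schur f zs)) / (r * L) / 32 = 1 / (32 * (r * kappaX f zs L)) := by
    rw [kappaX]
    field_simp
  rw [← hrate]
  exact hblocks.contraction_factors huv hr₂ hrμ hx

lemma exists_locallyContracting (hf : ∀ᶠ z in 𝓝 zs, DifferentiableAt ℝ f z)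
    (hf' : DifferentiableAt ℝ (fderiv ℝ f) zs) (hz : IsDiffStackelberg f zs) (hn : 0 < n)
    (hm : 0 < m) (hA : specNorm (blockA f zs) ≤ L) (hB : specNorm (blockB f zs) ≤ L)
    (hC : specNorm (blockC f zs) ≤ L) (hr : 2 * kappa f zs L ≤ r)
    {Q : Matrix (Fin n ⊕ Fin m) (Fin n ⊕ Fin m) ℂ} {ev : Fin n ⊕ Fin m → ℂ}
    (hQ : IsEigDecomp (matM f zs r) Q ev) :
    ∃ δ > 0, LocallyContracting (gradient f) (updateDir (1 / (4 * r * L)) (1 / (4 * L)))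
      (toEuclideanLin ((1 / (4 * r * L)) • matM f zs r)) (eigNorm Q) zs (specNorm Q⁻¹)
      (specNorm Q * (1 / (4 * L))) δ (1 / (32 * (r * kappaX f zs L))) := by
  have hL : 0 < L := (hz.stackelbergBlocks hn hm hA hB hC).L_pos
  have hr₂ : 2 ≤ r := by linarith [hz.one_le_kappa hm hA]
  have : 0 < r := by linarith
  have hκx := hz.one_le_kappaX hn hL
  have hrκ : 1 ≤ r * kappaX f zs L := one_le_mul_of_one_le_of_one_le (by linarith) hκx
  have hη : 1 / (4 * L) = r * (1 / (4 * r * L)) := by field_simp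
  have hθ₀ : 0 < 1 / (32 * (r * kappaX f zs L)) := by positivity
  have hθ₁ : 1 / (32 * (r * kappaX f zs L)) ≤ 1 := (div_le_one (by positivity)).2 (by linarith)
  have hP := specNorm_nonneg Q
  have hPi := specNorm_nonneg Q⁻¹
  have hh : 0 ≤ specNorm Q * (1 / (4 * L)) := by positivity
  have hfac (i) := hz.contraction_factors hn hm hA hB hC hr hQ (i := i) rfl
  have hdecomp := hQ.smul (1 / (4 * r * L))
  have hD (e : Pt n m) : eigNorm Q (updateDir (1 / (4 * r * L)) (1 / (4 * L)) e) ≤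
      specNorm Q * (1 / (4 * L)) * ‖e‖ := by
    rw [mul_assoc (specNorm Q)]
    refine (eigNorm_le _).trans (mul_le_mul_of_nonneg_left ?_ hP)
    refine norm_updateDir_le (by positivity) ?_ e
    rw [hη]
    exact le_mul_of_one_le_left (by positivity) (by linarith)
  obtain ⟨δ, hδ, hrem⟩ := exists_forall_seminorm_remainder_le (hasFDerivAt_gradient hf hf')
    hz.gradient_eq_zero hPi hh (norm_le_eigNorm hQ.1) hD (div_pos hθ₀ four_pos)
  exact ⟨δ, hδ, {
    c_nonneg := hPi
    h_nonneg := hh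
    theta_nonneg := hθ₀.le
    theta_le_one := hθ₁
    norm_le := norm_le_eigNorm hQ.1
    apply_D_le := hD
    apply_G_le := fun e =>
      (eigNorm_apply_le hdecomp zero_le_one (fun i => (hfac i).1) e).trans_eq (one_mul _)
    one_add_le := eigNorm_add_apply_le hdecomp (sub_nonneg.2 hθ₁) fun i => (hfac i).2.1
    one_add_sq_le := eigNorm_add_apply_add_apply_apply_le hdecomp (sub_nonneg.2 hθ₁)
      fun i => (hfac i).2.2
    remainder_le := fun z hzδ => by
      rw [← updateDir_hessian (hessian_isSymm hf hf'), ← hη]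
      exact hrem z hzδ }⟩

end Linearization

section Noise

variable {Ω : Type*} [MeasurableSpace Ω] {P : Measure Ω}

/-- The random vectors `ξ j` are square-integrable with `E ‖ξ j‖² ≤ v`; this is
how the size of the gradient noise enters Markov's inequality. -/
structure HasSecondMomentLE {E : Type*} [NormedAddCommGroup E] (P : Measure Ω) (v : ℝ)
    (ξ : ℕ → Ω → E) : Prop where
  memLp : ∀ j, MemLp (ξ j) 2 P
  integral_norm_sq_le : ∀ j, ∫ ω, ‖ξ j ω‖ ^ 2 ∂P ≤ v

lemma HasSecondMomentLE.one_sub_le_measureReal_sum_norm_le {E : Type*} [NormedAddCommGroup E]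
    [IsProbabilityMeasure P] {ξ : ℕ → Ω → E} {v a p : ℝ} {N : ℕ} (hξ : HasSecondMomentLE P v ξ)
    (ha : 0 < a) (hv : N ^ 2 * v ≤ p * a ^ 2) :
    1 - p ≤ P.real {ω | ∑ j ∈ Finset.range N, ‖ξ j ω‖ ≤ a} := by
  set V : Ω → ℝ := fun ω => N * ∑ j ∈ Finset.range N, ‖ξ j ω‖ ^ 2
  have hint (j : ℕ) : Integrable (fun ω => ‖ξ j ω‖ ^ 2) P :=
    (hξ.memLp j).integrable_norm_pow two_ne_zero
  have hsq (ω : Ω) : (∑ j ∈ Finset.range N, ‖ξ j ω‖) ^ 2 ≤ V ω := by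
    simpa using sq_sum_le_card_mul_sum_sq (s := Finset.range N) (f := fun j => ‖ξ j ω‖)
  have hmean : ∫ ω, V ω ∂P ≤ N ^ 2 * v := by
    calc ∫ ω, V ω ∂P = N * ∑ j ∈ Finset.range N, ∫ ω, ‖ξ j ω‖ ^ 2 ∂P := by
          rw [integral_const_mul, integral_finsetSum _ fun j _ => hint j]
      _ ≤ N * ∑ _j ∈ Finset.range N, v := by
          gcongr with j
          exact hξ.integral_norm_sq_le j
      _ = N ^ 2 * v := by
          rw [Finset.sum_const, Finset.card_range, nsmul_eq_mul]
          ring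
  have hmarkov : a ^ 2 * P.real {ω | a ^ 2 ≤ V ω} ≤ a ^ 2 * p := by
    refine (mul_meas_ge_le_integral_of_nonneg (.of_forall fun ω => (sq_nonneg _).trans (hsq ω))
      ((integrable_finsetSum _ fun j _ => hint j).const_mul _) _).trans ?_
    linarith
  have hcover : Set.univ ⊆
      {ω | ∑ j ∈ Finset.range N, ‖ξ j ω‖ ≤ a} ∪ {ω | a ^ 2 ≤ V ω} := fun ω _ =>
    (le_total _ a).imp_right fun h => (pow_le_pow_left₀ ha.le h 2).trans (hsq ω)
  have hunion := (measureReal_mono (μ := P) hcover).trans (measureReal_union_le _ _)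
  rw [probReal_univ] at hunion
  linarith [le_of_mul_le_mul_left hmarkov (by positivity)]

variable {n m : ℕ}

lemma continuous_xPart : Continuous (xPart : Pt n m → EuclideanSpace ℝ (Fin n)) := by
  unfold xPart
  fun_prop

lemma continuous_yPart : Continuous (yPart : Pt n m → EuclideanSpace ℝ (Fin m)) := by
  unfold yPart
  fun_prop

lemma IsMiniBatchNoise.hasSecondMomentLE {σ : ℝ} {S : ℕ} {ξ : ℕ → Ω → Pt n m}
    (hξ : IsMiniBatchNoise P σ S ξ) : HasSecondMomentLE P (2 * σ ^ 2 / S) ξ where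
  memLp := hξ.memLp
  integral_norm_sq_le j := by
    have hint : Integrable (fun ω => ‖ξ j ω‖ ^ 2) P :=
      (hξ.memLp j).integrable_norm_pow two_ne_zero
    have hmeas := (hξ.memLp j).aestronglyMeasurable
    have hx : Integrable (fun ω => ‖xPart (ξ j ω)‖ ^ 2) P := by
      refine hint.mono' ((continuous_xPart.comp_aestronglyMeasurable hmeas).norm.pow 2)
        (.of_forall fun ω => ?_)
      rw [Real.norm_of_nonneg (by positivity), norm_sq_eq_xPart_add_yPart (ξ j ω)]
      exact le_add_of_nonneg_right (by positivity)
    have hy : Integrable (fun ω => ‖yPart (ξ j ω)‖ ^ 2) P := by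
      refine hint.mono' ((continuous_yPart.comp_aestronglyMeasurable hmeas).norm.pow 2)
        (.of_forall fun ω => ?_)
      rw [Real.norm_of_nonneg (by positivity), norm_sq_eq_xPart_add_yPart (ξ j ω)]
      exact le_add_of_nonneg_left (by positivity)
    simp only [norm_sq_eq_xPart_add_yPart]
    rw [integral_add hx hy, mul_div_assoc, two_mul]
    exact add_le_add (hξ.var_x j) (hξ.var_y j)

end Noise

section Iterates

variable {n m : ℕ} {Ω : Type*} {f : Pt n m → ℝ} {g : ℕ → Ω → Pt n m → Pt n m} {ηx ηy : ℝ}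
  {z₀ : Pt n m}

lemma sgda_succ (k : ℕ) (ω : Ω) :
    sgda g ηx ηy z₀ (k + 1) ω = sgda g ηx ηy z₀ k ω + updateDir ηx ηy
      (gradient f (sgda g ηx ηy z₀ k ω) + noise f g (sgda g ηx ηy z₀) k ω) := by
  rw [noise, add_sub_cancel, ← step_eq_add, sgda]

lemma segQuery_even (k : ℕ) (ω : Ω) : segQuery g ηx ηy z₀ (2 * k) ω = seg g ηx ηy z₀ k ω := by
  simp [segQuery]

lemma segQuery_odd (k : ℕ) (ω : Ω) :
    segQuery g ηx ηy z₀ (2 * k + 1) ω = seg g ηx ηy z₀ k ω + updateDir ηx ηy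
      (gradient f (seg g ηx ηy z₀ k ω) + noise f g (segQuery g ηx ηy z₀) (2 * k) ω) := by
  have hdiv : (2 * k + 1) / 2 = k := by lia
  have hmod : (2 * k + 1) % 2 = 1 := by lia
  rw [noise, segQuery_even, add_sub_cancel, ← step_eq_add, segQuery, hdiv, hmod,
    if_neg one_ne_zero]

lemma seg_succ (k : ℕ) (ω : Ω) :
    seg g ηx ηy z₀ (k + 1) ω = seg g ηx ηy z₀ k ω + updateDir ηx ηy
      (gradient f (segQuery g ηx ηy z₀ (2 * k + 1) ω) +
        noise f g (segQuery g ηx ηy z₀) (2 * k + 1) ω) := by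
  rw [noise, add_sub_cancel, segQuery_odd (f := f), noise, segQuery_even, add_sub_cancel,
    ← step_eq_add, ← step_eq_add, seg]

variable {zs : Pt n m} {G : Pt n m →ₗ[ℝ] Pt n m} {N : Seminorm ℝ (Pt n m)}
  {c h δ θ v a d p ε : ℝ} {T : ℕ} [MeasurableSpace Ω] {P : Measure Ω} [IsProbabilityMeasure P]

lemma LocallyContracting.one_sub_le_measureReal_norm_sgda_sub_le
    (H : LocallyContracting (gradient f) (updateDir ηx ηy) G N zs c h δ θ)
    (hξ : HasSecondMomentLE P v (noise f g (sgda g ηx ηy z₀)))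
    (ha : 0 < a) (hv : T ^ 2 * v ≤ p * a ^ 2) (hnoise : c * (h * a) ≤ ε / 2)
    (hd : c * N (z₀ - zs) ≤ d) (hgeom : (1 - θ / 2) ^ T * d ≤ ε / 2) (hδ : d + ε / 2 ≤ δ) :
    1 - p ≤ P.real {ω | ‖sgda g ηx ηy z₀ T ω - zs‖ ≤ ε} := by
  refine (hξ.one_sub_le_measureReal_sum_norm_le ha hv).trans (measureReal_mono fun ω hω => ?_)
  set s := ∑ j ∈ Finset.range T, ‖noise f g (sgda g ηx ηy z₀) j ω‖
  have hs : c * (h * s) ≤ ε / 2 :=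
    (mul_le_mul_of_nonneg_left (mul_le_mul_of_nonneg_left hω H.h_nonneg) H.c_nonneg).trans hnoise
  have hT : ‖sgda g ηx ηy z₀ T ω - zs‖ ≤ (1 - θ / 2) ^ T * d + c * (h * s) :=
    H.norm_gradient_iterate_sub_le (z := fun k => sgda g ηx ηy z₀ k ω)
      (fun k => sgda_succ k ω) hd (show d + c * (h * s) ≤ δ by linarith)
  rw [Set.mem_ofPred_eq]
  linarith

lemma LocallyContracting.one_sub_le_measureReal_norm_seg_sub_le
    (H : LocallyContracting (gradient f) (updateDir ηx ηy) G N zs c h δ θ)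
    (hξ : HasSecondMomentLE P v (noise f g (segQuery g ηx ηy z₀)))
    (ha : 0 < a) (hv : (2 * T) ^ 2 * v ≤ p * a ^ 2) (hnoise : c * (2 * h * a) ≤ ε / 2)
    (hd : c * N (z₀ - zs) ≤ d) (hgeom : (1 - θ / 2) ^ T * d ≤ ε / 2) (hδ : d + ε / 2 ≤ δ) :
    1 - p ≤ P.real {ω | ‖seg g ηx ηy z₀ T ω - zs‖ ≤ ε} := by
  refine (hξ.one_sub_le_measureReal_sum_norm_le (N := 2 * T) ha (by exact_mod_cast hv)).trans
    (measureReal_mono fun ω hω => ?_)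
  set s := ∑ j ∈ Finset.range (2 * T), ‖noise f g (segQuery g ηx ηy z₀) j ω‖
  have hh : 0 ≤ 2 * h := mul_nonneg zero_le_two H.h_nonneg
  have hs : c * (2 * h * s) ≤ ε / 2 :=
    (mul_le_mul_of_nonneg_left (mul_le_mul_of_nonneg_left hω hh) H.c_nonneg).trans hnoise
  have hT : ‖seg g ηx ηy z₀ T ω - zs‖ ≤ (1 - θ / 2) ^ T * d + c * (2 * h * s) :=
    H.norm_extragradient_iterate_sub_le (z := fun k => seg g ηx ηy z₀ k ω)
      (z' := fun k => segQuery g ηx ηy z₀ (2 * k + 1) ω)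
      (fun k => segQuery_odd k ω) (fun k => seg_succ k ω) hd
      (show d + c * (2 * h * s) ≤ δ by linarith)
  rw [Set.mem_ofPred_eq]
  linarith

end Iterates

section Complexity

/-- The factor `K_S(p)` in the batch size. Markov's inequality asks for `133128 / p = 8 · 129² / p`;
the absolute value and the summand `1` make the factor positive for every real `p`. -/
noncomputable def batchConst (p : ℝ) : ℝ := 1 + 133128 / |p|

/-- The factor `K_G(p)` in the total number of gradient evaluations: `T ≤ 129 r κx ℓ`, and
extra-gradient makes two queries per iteration. -/
noncomputable def costConst (p : ℝ) : ℝ := 258 * (batchConst p + 1)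

lemma batchConst_pos (p : ℝ) : 0 < batchConst p := by
  unfold batchConst
  positivity

lemma costConst_pos (p : ℝ) : 0 < costConst p := by
  unfold costConst
  linarith [batchConst_pos p]

lemma natCeil_mul_le {X K : ℝ} (hX : 1 ≤ X) (hK : 0 ≤ K) : (⌈K * X⌉₊ : ℝ) ≤ (K + 1) * X := by
  linarith [Nat.ceil_lt_add_one (by positivity : 0 ≤ K * X)]

lemma cost_le {X b p : ℝ} {T S : ℕ} (hX : 0 ≤ X) (hT : (T : ℝ) ≤ 129 * X)
    (hS : S = max 1 ⌈batchConst p * b⌉₊) :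
    (sgdaCost T S : ℝ) ≤ costConst p * (X * max 1 b) ∧
      (segCost T S : ℝ) ≤ costConst p * (X * max 1 b) := by
  have hK := batchConst_pos p
  have hceil : ⌈batchConst p * b⌉₊ ≤ ⌈batchConst p * max 1 b⌉₊ := by
    gcongr
    exact le_max_right 1 b
  have hS' : (S : ℝ) ≤ (batchConst p + 1) * max 1 b := by
    refine le_trans ?_ (natCeil_mul_le (le_max_left 1 b) hK.le)
    rw [hS]
    exact_mod_cast max_le (Nat.one_le_ceil_iff.2 (by positivity)) hceil
  have hTS : (T : ℝ) * S ≤ 129 * X * ((batchConst p + 1) * max 1 b) := by gcongr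
  have hTS₀ : 0 ≤ (T : ℝ) * S := by positivity
  simp only [sgdaCost, segCost, costConst, Nat.cast_mul, Nat.cast_ofNat]
  constructor <;> linarith

lemma two_mul_sq_mul_variance_le {r κx CP σ L ε ℓ p : ℝ} {T S : ℕ} (hp : 0 < p) (hS : 0 < S)
    (hCP : CP ≠ 0) (hL : L ≠ 0) (hε : ε ≠ 0) (hT : (T : ℝ) ≤ 129 * (r * κx * ℓ))
    (hb : batchConst p * batchFactor r κx CP σ L ε ℓ ≤ S) :
    (2 * T) ^ 2 * (2 * σ ^ 2 / S) ≤ p * (L * ε / CP) ^ 2 := by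
  have hS' : (0 : ℝ) < S := Nat.cast_pos.2 hS
  have hb₀ : 0 ≤ batchFactor r κx CP σ L ε ℓ := by
    unfold batchFactor
    positivity
  have hbatch : 133128 * batchFactor r κx CP σ L ε ℓ ≤ p * S := by
    calc 133128 * batchFactor r κx CP σ L ε ℓ
        ≤ (p + 133128) * batchFactor r κx CP σ L ε ℓ := by gcongr; linarith
      _ = p * (batchConst p * batchFactor r κx CP σ L ε ℓ) := by
        rw [batchConst, abs_of_pos hp]
        field_simp
      _ ≤ p * S := by gcongr
  calc (2 * T) ^ 2 * (2 * σ ^ 2 / S)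
      ≤ (2 * (129 * (r * κx * ℓ))) ^ 2 * (2 * σ ^ 2 / S) := by gcongr
    _ = 133128 * batchFactor r κx CP σ L ε ℓ / S * (L * ε / CP) ^ 2 := by
      rw [batchFactor]
      field_simp
      ring
    _ ≤ p * (L * ε / CP) ^ 2 := by
      gcongr
      rwa [div_le_iff₀ hS']

lemma specNorm_inv_mul_threshold {ι : Type*} [Fintype ι] [DecidableEq ι] {Q : Matrix ι ι ℂ}
    {L : ℝ} (hQ : condNum Q ≠ 0) (hL : L ≠ 0) (ε : ℝ) :
    specNorm Q⁻¹ * (specNorm Q * (1 / (4 * L)) * (L * ε / condNum Q)) = ε / 4 := by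
  have hQ₁ : specNorm Q ≠ 0 := left_ne_zero_of_mul hQ
  have hQ₂ : specNorm Q⁻¹ ≠ 0 := right_ne_zero_of_mul hQ
  rw [condNum]
  field_simp

end Complexity

end Minimax

theorem theorem4_general {n m : ℕ} (hn : 0 < n) (hm : 0 < m) {f : Pt n m → ℝ} {zs : Pt n m}
    {L : ℝ} (hf : ∀ᶠ z in nhds zs, DifferentiableAt ℝ f z)
    (hf' : DifferentiableAt ℝ (fderiv ℝ f) zs) (hz : IsDiffStackelberg f zs)
    (hA : specNorm (blockA f zs) ≤ L) (hB : specNorm (blockB f zs) ≤ L)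
    (hC : specNorm (blockC f zs) ≤ L) {r : ℝ} (hr : 2 * kappa f zs L ≤ r)
    {Q : Matrix (Fin n ⊕ Fin m) (Fin n ⊕ Fin m) ℂ} {ev : Fin n ⊕ Fin m → ℂ}
    (hQ : IsEigDecomp (matM f zs r) Q ev) :
    ∃ δ : ℝ, 0 < δ ∧ ∀ z₀ : Pt n m, ‖z₀ - zs‖ ≤ δ → ∀ p : ℝ, 0 < p → ∀ σ ε : ℝ, 0 < ε →
      ε ≤ condNum Q * ‖z₀ - zs‖ → ∀ ℓ : ℝ, ℓ = logFactor (condNum Q) ‖z₀ - zs‖ ε →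
      ∀ b : ℝ, b = batchFactor r (kappaX f zs L) (condNum Q) σ L ε ℓ →
      ∀ T : ℕ, T = ⌈128 * (r * kappaX f zs L * ℓ)⌉₊ →
      (∀ S : ℕ, 1 ≤ S → batchConst p * b ≤ S →
        ∀ {Ω : Type*} [MeasurableSpace Ω] (P : Measure Ω) [IsProbabilityMeasure P]
          (g : ℕ → Ω → Pt n m → Pt n m),
          (HasSecondMomentLE P (2 * σ ^ 2 / S)
              (noise f g (sgda g (1 / (4 * r * L)) (1 / (4 * L)) z₀)) →
            1 - p ≤ P.real {ω | ‖sgda g (1 / (4 * r * L)) (1 / (4 * L)) z₀ T ω - zs‖ ≤ ε}) ∧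
          (HasSecondMomentLE P (2 * σ ^ 2 / S)
              (noise f g (segQuery g (1 / (4 * r * L)) (1 / (4 * L)) z₀)) →
            1 - p ≤ P.real {ω | ‖seg g (1 / (4 * r * L)) (1 / (4 * L)) z₀ T ω - zs‖ ≤ ε})) ∧
      (∀ S : ℕ, S = max 1 ⌈batchConst p * b⌉₊ →
        (sgdaCost T S : ℝ) ≤ costConst p * (r * kappaX f zs L * ℓ * max 1 b) ∧
        (segCost T S : ℝ) ≤ costConst p * (r * kappaX f zs L * ℓ * max 1 b)) := by
  obtain ⟨δ, hδ, H⟩ := exists_locallyContracting hf hf' hz hn hm hA hB hC hr hQ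
  have hL : 0 < L := (hz.stackelbergBlocks hn hm hA hB hC).L_pos
  have hrκ : 1 ≤ r * kappaX f zs L :=
    one_le_mul_of_one_le_of_one_le (by linarith [hz.one_le_kappa hm hA]) (hz.one_le_kappaX hn hL)
  have hCP : 0 ≤ condNum Q := mul_nonneg (specNorm_nonneg _) (specNorm_nonneg _)
  refine ⟨δ / (2 * (condNum Q + 1)), by positivity, ?_⟩
  rintro z₀ hz₀ p hp σ ε hε hεd ℓ rfl b rfl T rfl
  have hCPd : 0 < condNum Q * ‖z₀ - zs‖ := hε.trans_le hεd
  have hCP₀ : condNum Q ≠ 0 := left_ne_zero_of_mul hCPd.ne'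
  set κx := kappaX f zs L
  set ℓ := logFactor (condNum Q) ‖z₀ - zs‖ ε
  have hℓ : 1 ≤ ℓ := le_max_left _ _
  have hrκℓ : 1 ≤ r * κx * ℓ := one_le_mul_of_one_le_of_one_le hrκ hℓ
  have hT : (⌈128 * (r * κx * ℓ)⌉₊ : ℝ) ≤ 129 * (r * κx * ℓ) := by
    linarith [natCeil_mul_le hrκℓ (by norm_num : (0 : ℝ) ≤ 128)]
  have hinit := specNorm_inv_mul_eigNorm_le (Q := Q) (z₀ - zs)
  have hgeom := one_sub_inv_pow_ceil_mul_le hε hCPd hrκ hℓ (le_max_right _ _)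
  have hball : condNum Q * ‖z₀ - zs‖ + ε / 2 ≤ δ := by
    rw [le_div_iff₀ (by positivity)] at hz₀
    linarith [norm_nonneg (z₀ - zs)]
  refine ⟨fun S hS hSb Ω _ P _ g => ?_, fun S hS => cost_le (by linarith) hT hS⟩
  have ha : 0 < L * ε / condNum Q := by positivity
  have hnoise := specNorm_inv_mul_threshold hCP₀ hL.ne' ε
  have hvar := two_mul_sq_mul_variance_le hp hS hCP₀ hL.ne' hε.ne' hT hSb
  have hvar' : ⌈128 * (r * κx * ℓ)⌉₊ ^ 2 * (2 * σ ^ 2 / S) ≤ p * (L * ε / condNum Q) ^ 2 := by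
    refine le_trans ?_ hvar
    gcongr
    exact le_mul_of_one_le_left (Nat.cast_nonneg _) one_le_two
  exact ⟨fun hξ => H.one_sub_le_measureReal_norm_sgda_sub_le hξ ha hvar' (by linarith) hinit hgeom
      hball,
    fun hξ => H.one_sub_le_measureReal_norm_seg_sub_le hξ ha hvar (by linarith) hinit hgeom hball⟩

theorem theorem4 :
    ∃ (KT : ℝ) (KS KG : ℝ → ℝ), 0 < KT ∧ (∀ p, 0 < KS p ∧ 0 < KG p) ∧
    ∀ (n m : ℕ), 0 < n → 0 < m →
    ∀ (f : Pt n m → ℝ) (U : Set (Pt n m)) (zs : Pt n m) (L : ℝ),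
      IsOpen U → zs ∈ U → ContDiffOn ℝ 2 f U → IsDiffStackelberg f zs →
      specNorm (blockA f zs) ≤ L → specNorm (blockB f zs) ≤ L → specNorm (blockC f zs) ≤ L →
    ∀ (r : ℝ), 2 * kappa f zs L ≤ r →
    ∀ (Q : Matrix (Fin n ⊕ Fin m) (Fin n ⊕ Fin m) ℂ) (ev : Fin n ⊕ Fin m → ℂ),
      IsEigDecomp (matM f zs r) Q ev →
    ∃ δ : ℝ, 0 < δ ∧
    ∀ z₀ : Pt n m, ‖z₀ - zs‖ ≤ δ →
    ∀ p : ℝ, 0 < p → p < 1 →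
    ∀ σ : ℝ, 0 ≤ σ →
    ∀ ε : ℝ, 0 < ε → ε ≤ condNum Q * ‖z₀ - zs‖ →
    ∀ ℓ : ℝ, ℓ = logFactor (condNum Q) ‖z₀ - zs‖ ε →
    ∀ b : ℝ, b = batchFactor r (kappaX f zs L) (condNum Q) σ L ε ℓ →
    ∀ T : ℕ, T = ⌈KT * (r * kappaX f zs L * ℓ)⌉₊ →
      -- convergence with the above `T` and every batch size `S ≥ KS(p) * b`
      (∀ S : ℕ, 1 ≤ S → KS p * b ≤ S →
        ∀ {Ω : Type*} [MeasurableSpace Ω] (P : Measure Ω) [IsProbabilityMeasure P]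
          (g : ℕ → Ω → Pt n m → Pt n m),
          (IsMiniBatchNoise P σ S (noise f g (sgda g (1 / (4 * r * L)) (1 / (4 * L)) z₀)) →
            1 - p ≤ P.real {ω | ‖sgda g (1 / (4 * r * L)) (1 / (4 * L)) z₀ T ω - zs‖ ≤ ε}) ∧
          (IsMiniBatchNoise P σ S (noise f g (segQuery g (1 / (4 * r * L)) (1 / (4 * L)) z₀)) →
            1 - p ≤ P.real {ω | ‖seg g (1 / (4 * r * L)) (1 / (4 * L)) z₀ T ω - zs‖ ≤ ε})) ∧
      -- total number of gradient evaluations for the smallest such batch size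
      (∀ S : ℕ, S = max 1 ⌈KS p * b⌉₊ →
        (sgdaCost T S : ℝ) ≤ KG p * (r * kappaX f zs L * ℓ * max 1 b) ∧
        (segCost T S : ℝ) ≤ KG p * (r * kappaX f zs L * ℓ * max 1 b))
    := by
  refine ⟨128, batchConst, costConst, by norm_num, fun p => ⟨batchConst_pos p, costConst_pos p⟩,
    fun n m hn hm f U zs L hU hzU hf hz hA hB hC r hr Q ev hQ => ?_⟩
  obtain ⟨hf₁, hf₂⟩ :=
    eventually_differentiableAt_and_differentiableAt_fderiv (hf.contDiffAt (hU.mem_nhds hzU))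
  obtain ⟨δ, hδ, H⟩ := theorem4_general hn hm hf₁ hf₂ hz hA hB hC hr hQ
  refine ⟨δ, hδ, fun z₀ hz₀ p hp _ σ _ ε hε hεd ℓ hℓ b hb T hT => ?_⟩
  exact (H z₀ hz₀ p hp σ ε hε hεd ℓ hℓ b hb T hT).imp_left fun hconv S hS hSb Ω _ P _ g =>
    (hconv S hS hSb P g).imp (fun h hξ => h hξ.hasSecondMomentLE)
      fun h hξ => h hξ.hasSecondMomentLE
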